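/- Let $F$ be a number field of degree $n$ with discriminant $\Delta_F$ and ring of integers $O_F$. For an infinite prime $\sigma$ of $F$ put $\deg(\sigma)=1$ if $\sigma$ is real and $\deg(\sigma)=2$ if $\sigma$ is complex. Arakelov divisors are the formal sums $D=\sum_{\mathfrak p}n_{\mathfrak p}\mathfrak p+\sum_\sigma x_\sigma\sigma$ over the nonzero primes $\mathfrak p$ of $O_F$ and the infinite primes $\sigma$, with $n_{\mathfrak p}\in\mathbb Z$ almost all zero and $x_\sigma\in\mathbb R$. The degree of $D$ is $\sum_{\mathfrak p} n_{\mathfrak p}\log N(\mathfrak p)+\sum_\sigma\deg(\sigma)x_\sigma$, and the principal divisor of $f\in F^*$ is $(f)=\sum_{\mathfrak p}\mathrm{ord}_{\mathfrak p}(f)\,\mathfrak p-\sum_\sigma\log|\sigma(f)|\,\sigma$. The Arakelov class group $\mathrm{Pic}^0_F$ is the group of Arakelov divisors of degree $0$ modulo principal divisors. Its tangent space is $\{(x_\sigma)\in\bigoplus_\sigma\mathbb R:\sum_\sigma\deg(\sigma)x_\sigma=0\}$; the scalar product $\langle x,y\rangle=\sum_\sigma\deg(\sigma)x_\sigma y_\sigma$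 on it makes $\mathrm{Pic}^0_F$ a translation invariant Riemannian manifold, and $\mathrm{vol}(\mathrm{Pic}^0_F)$ is its Riemannian volume. For a fractional ideal $I=\prod_{\mathfrak p}\mathfrak p^{-n_{\mathfrak p}}$ let $d(I)=\sum_{\mathfrak p}n_{\mathfrak p}\mathfrak p-\frac1n\log N(I)\sum_\sigma\sigma$. Let $\mathrm{Red}_F$ be the set of reduced Arakelov divisors, that is, of the divisors $d(I)$ with $I$ a fractional ideal such that $1\in I$ and the only $g\in I$ with $|\sigma(g)|<1$ for all infinite primes $\sigma$ is $g=0$. Then $\mathrm{Red}_F$ is finite, $0<\mathrm{vol}(\mathrm{Pic}^0_F)<\infty$, and $$\frac{\#\mathrm{Red}_F}{\mathrm{vol}(\mathrm{Pic}^0_F)}\le\left(8\pi n\sqrt2\right)^{n/2};$$ if moreover $n\ge2$, that is, $F\ne\mathbb Q$, then $$\left(\log|\Delta_F|\right)^{-n}\le\frac{\#\mathrm{Red}_F}{\mathrm{vol}(\mathrm{Pic}^0_F)}.$$ -/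

import Mathlib

open MeasureTheory NumberField IsDedekindDomain
open scoped nonZeroDivisors NumberField

noncomputable section

namespace ArakelovClassGroup

/-- The real vector space `⊕_σ ℝ`, where `σ` runs over the infinite primes of `F`. It is a type of
its own because it carries the scalar product `⟪x, y⟫ = ∑_σ deg(σ) x_σ y_σ` (see `core`) induced from
`F ⊗ ℝ = ∏_σ F_σ`, not the sup norm of a product. -/
def InfDivisor (F : Type*) [Field F] : Type _ := InfinitePlace F → ℝ

section InfDivisor

variable (F : Type*) [Field F]

instance : AddCommGroup (InfDivisor F) := inferInstanceAs (AddCommGroup (InfinitePlace F → ℝ))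

instance : Module ℝ (InfDivisor F) := inferInstanceAs (Module ℝ (InfinitePlace F → ℝ))

variable [NumberField F]

instance : FiniteDimensional ℝ (InfDivisor F) :=
  inferInstanceAs (FiniteDimensional ℝ (InfinitePlace F → ℝ))

/-- The canonical scalar product `⟪x, y⟫ = Tr(x ȳ) = ∑_σ deg(σ) x_σ y_σ`, where `deg(σ)` is `1` for
real and `2` for complex `σ`. -/
@[reducible] def core : InnerProductSpace.Core ℝ (InfDivisor F) where
  inner x y := ∑ σ : InfinitePlace F, (σ.mult : ℝ) * (x σ * y σ)
  conj_inner_symm x y := by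
    simp only [conj_trivial]
    exact Finset.sum_congr rfl fun σ _ => by ring
  re_inner_nonneg x := by
    simp only [RCLike.re_to_real]
    exact Finset.sum_nonneg fun σ _ => mul_nonneg (Nat.cast_nonneg _) (mul_self_nonneg _)
  add_left x y z := by
    rw [← Finset.sum_add_distrib]
    refine Finset.sum_congr rfl fun σ _ => ?_
    change (σ.mult : ℝ) * ((x σ + y σ) * z σ) = _
    ring
  smul_left x y r := by
    simp only [conj_trivial]
    rw [Finset.mul_sum]
    refine Finset.sum_congr rfl fun σ _ => ?_
    change (σ.mult : ℝ) * ((r * x σ) * y σ) = _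
    ring
  definite x hx := by
    funext σ
    have h := (Finset.sum_eq_zero_iff_of_nonneg (fun τ _ => mul_nonneg
      (Nat.cast_nonneg (InfinitePlace.mult τ)) (mul_self_nonneg (x τ)))).1 hx σ (Finset.mem_univ σ)
    rcases mul_eq_zero.1 h with h | h
    · exact absurd h (Nat.cast_ne_zero.2 InfinitePlace.mult_ne_zero)
    · exact mul_self_eq_zero.1 h

instance : NormedAddCommGroup (InfDivisor F) := (core F).toNormedAddCommGroup

instance : InnerProductSpace ℝ (InfDivisor F) := InnerProductSpace.ofCore (core F).toCore

instance : MeasurableSpace (InfDivisor F) := borel _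

instance : BorelSpace (InfDivisor F) := ⟨rfl⟩

/-- The degree on `⊕_σ ℝ`: the linear form `x ↦ ∑_σ deg(σ) x_σ`. -/
def degInf : InfDivisor F →ₗ[ℝ] ℝ where
  toFun x := ∑ σ : InfinitePlace F, (σ.mult : ℝ) * x σ
  map_add' x y := by
    rw [← Finset.sum_add_distrib]
    refine Finset.sum_congr rfl fun σ _ => ?_
    change (σ.mult : ℝ) * (x σ + y σ) = _
    ring
  map_smul' r x := by
    rw [RingHom.id_apply, smul_eq_mul, Finset.mul_sum]
    refine Finset.sum_congr rfl fun σ _ => ?_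
    change (σ.mult : ℝ) * (r * x σ) = _
    ring

/-- The Euclidean space `(⊕_σ ℝ)⁰` of vectors of degree zero, with the scalar product of
`InfDivisor F`. It is the tangent space of `Pic⁰_F`. -/
abbrev InfDivisor0 : Submodule ℝ (InfDivisor F) := LinearMap.ker (degInf F)

/-- The Euclidean (Lebesgue) volume on `(⊕_σ ℝ)⁰`: a unit cube spanned by an orthonormal basis has
volume `1` (and it is the Dirac measure if the space is zero). -/
def euclideanVolume : Measure (InfDivisor0 F) :=
  (stdOrthonormalBasis ℝ (InfDivisor0 F)).toBasis.addHaar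

end InfDivisor

section Divisors

variable (F : Type*) [Field F]

/-- The group `Div_F` of Arakelov divisors: formal sums `∑_𝔭 n_𝔭 𝔭 + ∑_σ x_σ σ` over the nonzero
primes `𝔭` of `𝓞 F` (with `n_𝔭 ∈ ℤ`, almost all zero) and the infinite primes `σ` (with
`x_σ ∈ ℝ`). -/
def ArakelovDivisor : Type _ := (HeightOneSpectrum (𝓞 F) →₀ ℤ) × InfDivisor F

instance : AddCommGroup (ArakelovDivisor F) :=
  inferInstanceAs (AddCommGroup ((HeightOneSpectrum (𝓞 F) →₀ ℤ) × InfDivisor F))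

variable [NumberField F]

/-- The natural topology: discrete on `⊕_𝔭 ℤ`, Euclidean on `⊕_σ ℝ`. -/
instance : TopologicalSpace (ArakelovDivisor F) :=
  @instTopologicalSpaceProd (HeightOneSpectrum (𝓞 F) →₀ ℤ) (InfDivisor F) ⊥ inferInstance

/-- The degree `∑_𝔭 n_𝔭 log N(𝔭) + ∑_σ deg(σ) x_σ` of an Arakelov divisor. -/
def deg : ArakelovDivisor F →+ ℝ where
  toFun D := D.1.sum (fun p k => (k : ℝ) * Real.log (Ideal.absNorm p.asIdeal)) + degInf F D.2
  map_zero' := by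
    change (0 : HeightOneSpectrum (𝓞 F) →₀ ℤ).sum _ + degInf F 0 = 0
    simp
  map_add' D E := by
    change (D.1 + E.1).sum _ + degInf F (D.2 + E.2) = _
    rw [Finsupp.sum_add_index' (by simp) (by intros; push_cast; ring), map_add]
    ring

/-- The group `Div⁰_F` of Arakelov divisors of degree zero. -/
abbrev Div0 : AddSubgroup (ArakelovDivisor F) := (deg F).ker

variable {F}

/-- The finite divisor `∑_𝔭 ord_𝔭(I) 𝔭` of a fractional ideal `I`. -/
def idealDivisor (I : FractionalIdeal (𝓞 F)⁰ F) : HeightOneSpectrum (𝓞 F) →₀ ℤ :=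
  Finsupp.ofSupportFinite (fun p => FractionalIdeal.count F p I) (FractionalIdeal.finite_factors I)

variable (F)

/-- The homomorphism that maps `f ∈ F^*` to the principal Arakelov divisor
`(f) = ∑_𝔭 ord_𝔭(f) 𝔭 - ∑_σ log|σ(f)| σ`. -/
def principal : Additive Fˣ →+ ArakelovDivisor F where
  toFun f := (idealDivisor (FractionalIdeal.spanSingleton (𝓞 F)⁰ (f.toMul : F)),
    fun σ => -Real.log (σ (f.toMul : F)))
  map_zero' := by
    refine Prod.ext (Finsupp.ext fun p => ?_) (funext fun σ => ?_)
    · change FractionalIdeal.count F p (FractionalIdeal.spanSingleton (𝓞 F)⁰ ((1 : Fˣ) : F)) = 0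
      rw [Units.val_one, FractionalIdeal.spanSingleton_one, FractionalIdeal.count_one]
    · change -Real.log (σ ((1 : Fˣ) : F)) = 0
      simp
  map_add' f g := by
    refine Prod.ext (Finsupp.ext fun p => ?_) (funext fun σ => ?_)
    · change FractionalIdeal.count F p (FractionalIdeal.spanSingleton (𝓞 F)⁰
          ((f.toMul * g.toMul : Fˣ) : F)) =
        FractionalIdeal.count F p (FractionalIdeal.spanSingleton (𝓞 F)⁰ (f.toMul : F)) +
          FractionalIdeal.count F p (FractionalIdeal.spanSingleton (𝓞 F)⁰ (g.toMul : F))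
      rw [Units.val_mul, ← FractionalIdeal.spanSingleton_mul_spanSingleton,
        FractionalIdeal.count_mul] <;>
      exact FractionalIdeal.spanSingleton_ne_zero_iff.2 (Units.ne_zero _)
    · change -Real.log (σ ((f.toMul * g.toMul : Fˣ) : F)) =
        -Real.log (σ (f.toMul : F)) + -Real.log (σ (g.toMul : F))
      rw [Units.val_mul, map_mul, Real.log_mul (by simp) (by simp)]
      ring

/-- The Arakelov class group `Pic⁰_F`: divisors of degree zero modulo principal divisors, a
topological group with the quotient topology. -/
abbrev Pic0 : Type _ := Div0 F ⧸ (principal F).range.addSubgroupOf (Div0 F)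

instance : MeasurableSpace (Pic0 F) := borel _

instance : BorelSpace (Pic0 F) := ⟨rfl⟩

variable {F}

/-- The divisor `∑_σ x_σ σ` of degree zero attached to `x ∈ (⊕_σ ℝ)⁰`. -/
def ofInf (x : InfDivisor0 F) : Div0 F :=
  ⟨((0, x.1) : (HeightOneSpectrum (𝓞 F) →₀ ℤ) × InfDivisor F), by
    change (0 : HeightOneSpectrum (𝓞 F) →₀ ℤ).sum _ + degInf F x.1 = 0
    rw [Finsupp.sum_zero_index, zero_add]
    exact x.2⟩

/-- The isometric parametrization `x ↦ P + [∑_σ x_σ σ]` of the connected component of `P ∈ Pic⁰_F`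
by the tangent space `(⊕_σ ℝ)⁰` (the exponential map at `P`). -/
def chart (P : Pic0 F) (x : InfDivisor0 F) : Pic0 F := P + QuotientAddGroup.mk (ofInf x)

lemma continuous_chart (P : Pic0 F) : Continuous (chart P) := by
  obtain ⟨D, rfl⟩ := QuotientAddGroup.mk_surjective P
  have h : Continuous fun x : InfDivisor0 F => D + ofInf x := by
    refine Continuous.subtype_mk ?_ _
    let t : TopologicalSpace (HeightOneSpectrum (𝓞 F) →₀ ℤ) := ⊥
    have h2 : Continuous fun x : InfDivisor0 F => D.1.2 + (x : InfDivisor F) :=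
      continuous_const.add continuous_subtype_val
    exact Continuous.prodMk (continuous_const (y := D.1.1 + 0)) h2
  exact continuous_quotient_mk'.comp h

variable (F)

/-- The Riemannian volume on `Pic⁰_F`, for the translation invariant Riemannian structure given by
the scalar product of the tangent space `(⊕_σ ℝ)⁰`. The measure is glued from charts: `chart P` is a
local isometry, so a Borel set `A` of `(⊕_σ ℝ)⁰` on which it is injective contributes the image of
the Euclidean volume of `A`. These images agree where they overlap, and the volume is their
supremum in the lattice of measures. -/
def riemannianVolume : Measure (Pic0 F) :=
  ⨆ (P : Pic0 F) (A : Set (InfDivisor0 F)) (_ : MeasurableSet A) (_ : Set.InjOn (chart P) A),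
    ((euclideanVolume F).restrict A).map (chart P)

/-- The volume of `Pic⁰_F`, as an extended nonnegative real number. -/
def volPic0 : ENNReal := riemannianVolume F Set.univ

variable {F}

/-- The Arakelov divisor `d(I) = (I, N(I)^(-1/n))` of a fractional ideal `I = ∏ 𝔭^(-n_𝔭)`: it has
coefficients `n_𝔭 = -ord_𝔭(I)` at the finite primes and `-(1/n) log N(I)` at all infinite primes. -/
def d (I : (FractionalIdeal (𝓞 F)⁰ F)ˣ) : ArakelovDivisor F :=
  (-idealDivisor (I : FractionalIdeal (𝓞 F)⁰ F),
    fun _ => -(1 / (Module.finrank ℚ F : ℝ)) *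
      Real.log (FractionalIdeal.absNorm (I : FractionalIdeal (𝓞 F)⁰ F) : ℚ))

/-- A nonzero element `f` of a fractional ideal `I` is minimal if `0` is the only `g ∈ I` with
`|σ(g)| < |σ(f)|` for all infinite primes `σ`. -/
def IsMinimal (I : FractionalIdeal (𝓞 F)⁰ F) (f : F) : Prop :=
  f ∈ I ∧ f ≠ 0 ∧ ∀ g ∈ I, (∀ σ : InfinitePlace F, σ g < σ f) → g = 0

variable (F)

/-- The set `Red_F` of reduced Arakelov divisors. -/
def Red : Set (ArakelovDivisor F) :=
  {D | ∃ I : (FractionalIdeal (𝓞 F)⁰ F)ˣ, D = d I ∧ IsMinimal (I : FractionalIdeal (𝓞 F)⁰ F) 1}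

end Divisors

end ArakelovClassGroup

end

/-!
The reduced Arakelov divisors correspond to the fractional ideals `I` in which `1` is minimal,
since `d I` determines `I` (`d_injective`); only their number matters. Each of them is placed at
the point `idealClass I` of `Pic⁰_F`, the class of the divisor of degree zero with the finite part
of `d I` and equal infinite coefficients. A point `[E]` of `Pic⁰_F` is a fractional ideal `J` with
weights at the infinite places, and the representations `[E] = [I] + [b]` with `I` reduced and `b`
in the tangent space correspond, up to roots of unity, to the minimal elements `f` of `J`: then
`J = f I`, and `b` records the weighted logarithms of the `|σ(f)|` (`idealClass_add_toPic_eq_iff`).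

* Covering (`exists_reduced_near`). An element of `J` whose weighted maximum norm is least is
  minimal, and by Minkowski's theorem that norm is at most the `2n`-th root of `|Δ_F|`. As `b` has
  degree zero, a one-sided bound for its coordinates bounds its length. So the balls of radius
  `(1/2) log |Δ_F|` around the classes of reduced ideals cover `Pic⁰_F`.
* Packing (`encard_reduced_near_le`). Let `f` and `g` be minimal elements of `J` that lead to
  vectors `b` of length less than `(log 2)/4`. If they have the same signs at the real places and
  lie in the same sectors of angle `π/4` at the complex places, then `f - g` is smaller than `f`
  or than `g` at every infinite place, so `f = g`. Hence no point lies in more than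
  `2^(r₁ + r₂) 4^r₂` of the balls of radius `(log 2)/4` around the classes of reduced ideals.

The kernel of the exponential map is the lattice of logarithms of units, and every component of
`Pic⁰_F` is a torus with the volume of a fundamental domain of that lattice (`volPic0_eq`).
Integrating over fundamental domains turns packing and covering into bounds for `#Red_F` in terms
of the volume of `Pic⁰_F` and of Euclidean balls (`encard_reducedIdeals_mul_le`, `volPic0_le`).
With `r = r₁ + r₂ - 1`, a ball of radius `R` has volume at least that of the inscribed cube,
`(2R/√r)^r`, and at most that of the circumscribed cube, `(2R)^r`. The second estimate gives
`(log |Δ_F|)^r`, which is at most `(log |Δ_F|)^n` because `log |Δ_F| ≥ 1` for `n ≥ 2`; the first one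
gives the constant `(8πn√2)^(n/2)` because `16/(log 2)^2 ≤ 8π√2`.
-/

noncomputable section

namespace ArakelovClassGroup

/-! ### Coordinates -/

section Coordinates

variable {F : Type*} [Field F]

lemma degInf_apply [NumberField F] (x : InfDivisor F) :
    degInf F x = ∑ σ : InfinitePlace F, (σ.mult : ℝ) * x σ := rfl

lemma InfDivisor.norm_sq_eq [NumberField F] (x : InfDivisor F) :
    ‖x‖ ^ 2 = ∑ σ : InfinitePlace F, (σ.mult : ℝ) * x σ ^ 2 := by
  rw [← real_inner_self_eq_norm_sq]
  exact Finset.sum_congr rfl fun σ _ => by rw [pow_two]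

lemma InfDivisor.abs_apply_le_norm [NumberField F] (x : InfDivisor F) (σ : InfinitePlace F) :
    |x σ| ≤ ‖x‖ := by
  refine abs_le_of_sq_le_sq' ?_ (norm_nonneg _) |> abs_le.2
  rw [InfDivisor.norm_sq_eq]
  refine le_trans ?_ (Finset.single_le_sum (f := fun σ : InfinitePlace F => (σ.mult : ℝ) * x σ ^ 2)
    (fun τ _ => by positivity) (Finset.mem_univ σ))
  have : (1 : ℝ) ≤ σ.mult := by exact_mod_cast InfinitePlace.one_le_mult
  nlinarith [sq_nonneg (x σ)]

variable [NumberField F]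

lemma deg_apply (D : ArakelovDivisor F) :
    deg F D = D.1.sum (fun p k => (k : ℝ) * Real.log (Ideal.absNorm p.asIdeal)) + degInf F D.2 :=
  rfl

lemma ofInf_add (x y : InfDivisor0 F) : ofInf (x + y) = ofInf x + ofInf y :=
  Subtype.ext (Prod.ext (add_zero (0 : HeightOneSpectrum (𝓞 F) →₀ ℤ)).symm rfl)

lemma sum_mult_eq_finrank : ∑ σ : InfinitePlace F, (σ.mult : ℝ) = Module.finrank ℚ F := by
  exact_mod_cast InfinitePlace.sum_mult_eq (K := F)

lemma degInf_const (c : ℝ) :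
    degInf F (fun _ => c : InfinitePlace F → ℝ) = Module.finrank ℚ F * c := by
  change ∑ σ : InfinitePlace F, (σ.mult : ℝ) * c = _
  rw [← Finset.sum_mul, sum_mult_eq_finrank]

end Coordinates

/-! ### Fractional ideals and their divisors -/

section Ideals

variable {F : Type*} [Field F] [NumberField F]

lemma idealDivisor_apply (I : FractionalIdeal (𝓞 F)⁰ F) (p : HeightOneSpectrum (𝓞 F)) :
    idealDivisor I p = FractionalIdeal.count F p I := rfl

lemma idealDivisor_mul {I J : FractionalIdeal (𝓞 F)⁰ F} (hI : I ≠ 0) (hJ : J ≠ 0) :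
    idealDivisor (I * J) = idealDivisor I + idealDivisor J :=
  Finsupp.ext fun p => FractionalIdeal.count_mul F p hI hJ

lemma idealDivisor_prod {I : FractionalIdeal (𝓞 F)⁰ F} (hI : I ≠ 0) :
    (idealDivisor I).prod (fun p k => (p.asIdeal : FractionalIdeal (𝓞 F)⁰ F) ^ k) = I := by
  conv_rhs => rw [← FractionalIdeal.finprod_heightOneSpectrum_factorization' F hI]
  rw [Finsupp.prod, finprod_eq_finsetProd_of_mulSupport_subset]
  · rfl
  · intro p hp
    rw [Function.mem_mulSupport] at hp
    simp only [Finset.mem_coe, Finsupp.mem_support_iff, idealDivisor_apply]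
    contrapose! hp
    rw [hp, zpow_zero]

lemma idealDivisor_injective {I J : FractionalIdeal (𝓞 F)⁰ F} (hI : I ≠ 0) (hJ : J ≠ 0)
    (h : idealDivisor I = idealDivisor J) : I = J := by
  rw [← idealDivisor_prod hI, ← idealDivisor_prod hJ, h]

lemma exists_idealDivisor_eq (e : HeightOneSpectrum (𝓞 F) →₀ ℤ) :
    ∃ J : (FractionalIdeal (𝓞 F)⁰ F)ˣ, idealDivisor (J : FractionalIdeal (𝓞 F)⁰ F) = e := by
  have h0 : e.prod (fun p k => (p.asIdeal : FractionalIdeal (𝓞 F)⁰ F) ^ k) ≠ 0 :=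
    Finset.prod_ne_zero_iff.2 fun p _ =>
      zpow_ne_zero _ (FractionalIdeal.coeIdeal_ne_zero.mpr p.ne_bot)
  exact ⟨Units.mk0 _ h0, Finsupp.ext fun p => FractionalIdeal.count_finsuppProd F p e⟩

lemma absNorm_pos {I : FractionalIdeal (𝓞 F)⁰ F} (hI : I ≠ 0) :
    (0 : ℝ) < (FractionalIdeal.absNorm I : ℚ) := by
  have h := FractionalIdeal.absNorm_nonneg I
  have h' : FractionalIdeal.absNorm I ≠ 0 := fun h => hI (FractionalIdeal.absNorm_eq_zero_iff.1 h)
  exact_mod_cast lt_of_le_of_ne h h'.symm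

lemma log_absNorm {I : FractionalIdeal (𝓞 F)⁰ F} (hI : I ≠ 0) :
    Real.log (FractionalIdeal.absNorm I : ℚ) =
      (idealDivisor I).sum fun p k => (k : ℝ) * Real.log (Ideal.absNorm p.asIdeal) := by
  conv_lhs => rw [← idealDivisor_prod hI]
  rw [Finsupp.prod, map_prod, Rat.cast_prod, Real.log_prod]
  · refine Finset.sum_congr rfl fun p _ => ?_
    rw [map_zpow₀, FractionalIdeal.coeIdeal_absNorm]
    push_cast
    rw [Real.log_zpow]
  · intro p _
    refine (absNorm_pos (zpow_ne_zero _ (FractionalIdeal.coeIdeal_ne_zero.mpr p.ne_bot))).ne'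

lemma log_absNorm_spanSingleton (f : Fˣ) :
    Real.log (FractionalIdeal.absNorm (FractionalIdeal.spanSingleton (𝓞 F)⁰ (f : F)) : ℚ) =
      ∑ σ : InfinitePlace F, (σ.mult : ℝ) * Real.log (σ (f : F)) := by
  rw [FractionalIdeal.absNorm_span_singleton]
  rw [← InfinitePlace.prod_eq_abs_norm, Real.log_prod]
  · exact Finset.sum_congr rfl fun σ _ => Real.log_pow _ _
  · intro σ _
    exact pow_ne_zero _ (by simp)

lemma spanSingleton_unit_ne_zero (f : Fˣ) :
    FractionalIdeal.spanSingleton (𝓞 F)⁰ (f : F) ≠ 0 :=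
  FractionalIdeal.spanSingleton_ne_zero_iff.2 f.ne_zero

@[simp] lemma principal_fst (f : Fˣ) : (principal F (Additive.ofMul f)).1 =
    idealDivisor (FractionalIdeal.spanSingleton (𝓞 F)⁰ (f : F)) := rfl

@[simp] lemma principal_snd (f : Fˣ) (σ : InfinitePlace F) :
    (principal F (Additive.ofMul f)).2 σ = -Real.log (σ (f : F)) := rfl

end Ideals

/-! ### Classes of fractional ideals in the Arakelov class group -/

section Classes

variable {F : Type*} [Field F] [NumberField F]

variable (F) in
/-- The homomorphism `x ↦ [∑_σ x_σ σ]` from the tangent space to the Arakelov class group. -/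
def toPic : InfDivisor0 F →+ Pic0 F where
  toFun x := QuotientAddGroup.mk (ofInf x)
  map_zero' := (QuotientAddGroup.eq_zero_iff _).2 (zero_mem _)
  map_add' x y := by rw [ofInf_add]; rfl

lemma toPic_apply (x : InfDivisor0 F) : toPic F x = QuotientAddGroup.mk (ofInf x) := rfl

lemma chart_eq (P : Pic0 F) (x : InfDivisor0 F) : chart P x = P + toPic F x := rfl

/-- `N(I)^(1/n)` on a logarithmic scale. -/
def logNorm (I : (FractionalIdeal (𝓞 F)⁰ F)ˣ) : ℝ :=
  1 / (Module.finrank ℚ F : ℝ) *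
    Real.log (FractionalIdeal.absNorm (I : FractionalIdeal (𝓞 F)⁰ F) : ℚ)

lemma finrank_mul_logNorm (I : (FractionalIdeal (𝓞 F)⁰ F)ˣ) :
    Module.finrank ℚ F * logNorm I =
      Real.log (FractionalIdeal.absNorm (I : FractionalIdeal (𝓞 F)⁰ F) : ℚ) := by
  have : (Module.finrank ℚ F : ℝ) ≠ 0 := Nat.cast_ne_zero.2 Module.finrank_pos.ne'
  rw [logNorm]
  field_simp

/-- The divisor of degree zero with finite part `-∑_𝔭 ord_𝔭(I) 𝔭` all of whose infinite
coefficients are equal, namely to `(1/n) log N(I)`. It has the same finite part as `d I` and the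
opposite infinite part: with that sign the degree is zero for every `I`. -/
def balancedDivisor (I : (FractionalIdeal (𝓞 F)⁰ F)ˣ) : Div0 F :=
  ⟨((-idealDivisor (I : FractionalIdeal (𝓞 F)⁰ F), fun _ => logNorm I) :
      (HeightOneSpectrum (𝓞 F) →₀ ℤ) × InfDivisor F), by
    change (-idealDivisor (I : FractionalIdeal (𝓞 F)⁰ F)).sum _ + degInf F (fun _ => logNorm I) = 0
    rw [degInf_const, finrank_mul_logNorm, log_absNorm I.ne_zero, Finsupp.sum_neg_index (by simp)]
    simp [Finsupp.sum]⟩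

/-- The class of `balancedDivisor I` in the Arakelov class group. -/
def idealClass (I : (FractionalIdeal (𝓞 F)⁰ F)ˣ) : Pic0 F := QuotientAddGroup.mk (balancedDivisor I)

lemma mk_eq_mk_iff (D E : Div0 F) :
    (QuotientAddGroup.mk D : Pic0 F) = QuotientAddGroup.mk E ↔
      ∃ f : Fˣ, (D : ArakelovDivisor F) = E + principal F (Additive.ofMul f) := by
  rw [eq_comm, QuotientAddGroup.eq, AddSubgroup.mem_addSubgroupOf]
  constructor
  · rintro ⟨f, hf⟩
    refine ⟨f.toMul, ?_⟩
    change principal F (Additive.ofMul f.toMul) = -(E : ArakelovDivisor F) + D at hf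
    rw [hf]
    abel
  · rintro ⟨f, hf⟩
    refine ⟨Additive.ofMul f, ?_⟩
    change principal F (Additive.ofMul f) = -(E : ArakelovDivisor F) + D
    rw [hf]
    abel

/-- Every representation `[E] = [I] + [b]` comes from an element `f` of the fractional ideal `J`
attached to `E` with `J = f I`, and `b` is determined by the logarithms of the `|σ(f)|`. -/
lemma idealClass_add_toPic_eq_iff {E : Div0 F} {J : (FractionalIdeal (𝓞 F)⁰ F)ˣ}
    (hJ : idealDivisor (J : FractionalIdeal (𝓞 F)⁰ F) = -(E : ArakelovDivisor F).1)
    (I : (FractionalIdeal (𝓞 F)⁰ F)ˣ) (b : InfDivisor0 F) :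
    idealClass I + toPic F b = QuotientAddGroup.mk E ↔
      ∃ f : Fˣ, (J : FractionalIdeal (𝓞 F)⁰ F) =
          FractionalIdeal.spanSingleton (𝓞 F)⁰ (f : F) * (I : FractionalIdeal (𝓞 F)⁰ F) ∧
        ∀ σ : InfinitePlace F,
          logNorm I + (b : InfDivisor F) σ =
            (E : ArakelovDivisor F).2 σ - Real.log (σ (f : F)) := by
  have key : idealClass I + toPic F b = QuotientAddGroup.mk (balancedDivisor I + ofInf b) := rfl
  rw [key, mk_eq_mk_iff]
  refine exists_congr fun f => ?_
  have hfst : ((balancedDivisor I + ofInf b : Div0 F) : ArakelovDivisor F).1 =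
      -idealDivisor (I : FractionalIdeal (𝓞 F)⁰ F) := add_zero _
  have hsplit : ((balancedDivisor I + ofInf b : Div0 F) : ArakelovDivisor F) =
      E + principal F (Additive.ofMul f) ↔
      ((balancedDivisor I + ofInf b : Div0 F) : ArakelovDivisor F).1 =
        (E : ArakelovDivisor F).1 + (principal F (Additive.ofMul f)).1 ∧
      ∀ σ, ((balancedDivisor I + ofInf b : Div0 F) : ArakelovDivisor F).2 σ =
        (E : ArakelovDivisor F).2 σ + (principal F (Additive.ofMul f)).2 σ :=
    ⟨fun h => ⟨congrArg Prod.fst h, fun σ => congrFun (congrArg Prod.snd h) σ⟩,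
      fun h => Prod.ext h.1 (funext h.2)⟩
  rw [hsplit]
  refine and_congr ?_ (forall_congr' fun σ => ?_)
  · rw [hfst, principal_fst]
    constructor
    · intro h
      refine idealDivisor_injective J.ne_zero
        (mul_ne_zero (spanSingleton_unit_ne_zero f) I.ne_zero) ?_
      rw [idealDivisor_mul (spanSingleton_unit_ne_zero f) I.ne_zero, hJ]
      rw [neg_eq_iff_eq_neg] at h ⊢
      rw [h]
      abel
    · intro h
      rw [h, idealDivisor_mul (spanSingleton_unit_ne_zero f) I.ne_zero] at hJ
      rw [← neg_eq_iff_eq_neg] at hJ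
      rw [← hJ]
      abel
  · rw [principal_snd, ← sub_eq_add_neg]
    rfl

lemma exists_ideal_of_divisor (E : Div0 F) : ∃ J : (FractionalIdeal (𝓞 F)⁰ F)ˣ,
    idealDivisor (J : FractionalIdeal (𝓞 F)⁰ F) = -(E : ArakelovDivisor F).1 :=
  exists_idealDivisor_eq _

/-- As `E` has degree zero, its infinite part has degree `log N(J)`. -/
lemma degInf_eq_logNorm {E : Div0 F} {J : (FractionalIdeal (𝓞 F)⁰ F)ˣ}
    (hJ : idealDivisor (J : FractionalIdeal (𝓞 F)⁰ F) = -(E : ArakelovDivisor F).1) :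
    degInf F (E : ArakelovDivisor F).2 = Module.finrank ℚ F * logNorm J := by
  have h : deg F (E : ArakelovDivisor F) = 0 := E.2
  rw [deg_apply] at h
  rw [finrank_mul_logNorm, log_absNorm J.ne_zero, hJ, Finsupp.sum_neg_index (by simp)]
  simp only [Finsupp.sum, Int.cast_neg, neg_mul, Finset.sum_neg_distrib] at h ⊢
  linarith

end Classes

/-! ### Minkowski's theorem: minimal elements and reduced ideals -/

section Minkowski

variable {F : Type*} [Field F] [NumberField F]

lemma place_pos {F : Type*} [Field F] {f : F} (hf : f ≠ 0) (σ : InfinitePlace F) : 0 < σ f :=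
  InfinitePlace.pos_iff.2 hf

lemma abs_discr_pos : (0 : ℝ) < |(discr F : ℝ)| := by
  exact_mod_cast abs_pos.2 (discr_ne_zero F)

/-- Minkowski's convex body theorem on a logarithmic scale; the factor `(2/π)^r₂` is given away. -/
lemma exists_mem_place_lt_exp (J : (FractionalIdeal (𝓞 F)⁰ F)ˣ) (t : InfinitePlace F → ℝ)
    (ht : Module.finrank ℚ F * logNorm J + Real.log |(discr F : ℝ)| / 2 <
      ∑ σ : InfinitePlace F, (σ.mult : ℝ) * t σ) :
    ∃ g ∈ (J : FractionalIdeal (𝓞 F)⁰ F), g ≠ 0 ∧ ∀ σ : InfinitePlace F, σ g < Real.exp (t σ) := by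
  classical
  suffices h : mixedEmbedding.minkowskiBound F J <
      volume (mixedEmbedding.convexBodyLT F fun σ => (Real.exp (t σ)).toNNReal) by
    obtain ⟨g, hg, hg0, hlt⟩ := mixedEmbedding.exists_ne_zero_mem_ideal_lt F J h
    exact ⟨g, hg, hg0, fun σ => by simpa [Real.coe_toNNReal _ (Real.exp_pos _).le] using hlt σ⟩
  have hN := absNorm_pos J.ne_zero
  rw [mixedEmbedding.convexBodyLT_volume, mixedEmbedding.minkowskiBound,
    mixedEmbedding.volume_fundamentalDomain_fractionalIdealLatticeBasis,
    mixedEmbedding.volume_fundamentalDomain_latticeBasis, mixedEmbedding.finrank]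
  have h1 : (ENNReal.ofReal ((FractionalIdeal.absNorm J.1 : ℚ) : ℝ) *
      ((2 : ENNReal)⁻¹ ^ InfinitePlace.nrComplexPlaces F * (NNReal.sqrt ‖discr F‖₊ : ENNReal)) *
      2 ^ Module.finrank ℚ F) =
      ENNReal.ofReal (((FractionalIdeal.absNorm J.1 : ℚ) : ℝ) *
        (2⁻¹ ^ InfinitePlace.nrComplexPlaces F * √|(discr F : ℝ)|) * 2 ^ Module.finrank ℚ F) := by
    rw [ENNReal.ofReal_mul (by positivity), ENNReal.ofReal_mul (by positivity),
      ENNReal.ofReal_mul (by positivity), ENNReal.ofReal_pow (by positivity),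
      ENNReal.ofReal_pow (by positivity), ENNReal.ofReal_inv_of_pos (by norm_num),
      ENNReal.ofReal_ofNat]
    congr 3
    rw [← ENNReal.ofReal_coe_nnreal, Real.coe_sqrt, coe_nnnorm, Int.norm_eq_abs]
  rw [h1]
  have h2 : ((mixedEmbedding.convexBodyLTFactor F : NNReal) : ENNReal) *
      ((∏ σ : InfinitePlace F, (Real.exp (t σ)).toNNReal ^ σ.mult : NNReal) :
        ENNReal) =
      ENNReal.ofReal (2 ^ InfinitePlace.nrRealPlaces F * Real.pi ^ InfinitePlace.nrComplexPlaces F *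
        Real.exp (∑ σ : InfinitePlace F, (σ.mult : ℝ) * t σ)) := by
    rw [← ENNReal.coe_mul, ← ENNReal.ofReal_coe_nnreal]
    congr 1
    simp [Real.exp_sum, Real.exp_nat_mul, Real.coe_toNNReal _ (Real.exp_pos _).le]
  refine lt_of_lt_of_eq ?_ h2.symm
  rw [ENNReal.ofReal_lt_ofReal_iff (by positivity)]
  have h3 : ((FractionalIdeal.absNorm J.1 : ℚ) : ℝ) * √|(discr F : ℝ)| <
      Real.exp (∑ σ : InfinitePlace F, (σ.mult : ℝ) * t σ) := by
    rw [← Real.log_lt_iff_lt_exp (mul_pos hN (Real.sqrt_pos.2 abs_discr_pos)),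
      Real.log_mul hN.ne' (Real.sqrt_pos.2 abs_discr_pos).ne', Real.log_sqrt (abs_nonneg _)]
    rwa [finrank_mul_logNorm] at ht
  have h4 : (2 : ℝ)⁻¹ ^ InfinitePlace.nrComplexPlaces F * 2 ^ Module.finrank ℚ F =
      2 ^ InfinitePlace.nrRealPlaces F * 2 ^ InfinitePlace.nrComplexPlaces F := by
    rw [← InfinitePlace.card_add_two_mul_card_eq_rank, pow_add, two_mul, pow_add, inv_pow]
    field_simp
  calc _ = (((2 : ℝ)⁻¹ ^ InfinitePlace.nrComplexPlaces F * 2 ^ Module.finrank ℚ F) *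
        (((FractionalIdeal.absNorm J.1 : ℚ) : ℝ) * √|(discr F : ℝ)|)) := by ring
    _ < ((2 : ℝ)⁻¹ ^ InfinitePlace.nrComplexPlaces F * 2 ^ Module.finrank ℚ F) *
        Real.exp (∑ σ : InfinitePlace F, (σ.mult : ℝ) * t σ) := by gcongr
    _ ≤ _ := by
      rw [h4]
      have := Real.two_le_pi
      gcongr

/-- A fractional ideal is discrete in `F ⊗ ℝ`. -/
lemma finite_mem_place_le (I : FractionalIdeal (𝓞 F)⁰ F) (B : ℝ) :
    {g : F | g ∈ I ∧ ∀ σ : InfinitePlace F, σ g ≤ B}.Finite := by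
  obtain ⟨a, ha, h⟩ := I.isFractional
  have ha0 : (algebraMap (𝓞 F) F a) ≠ 0 := by simpa using nonZeroDivisors.ne_zero ha
  set C := ∑ φ : F →+* ℂ, ‖φ (algebraMap (𝓞 F) F a)‖
  refine Set.Finite.of_finite_image (f := fun g => algebraMap (𝓞 F) F a * g)
    ((Embeddings.finite_of_norm_le F ℂ (C * B)).subset ?_)
    (mul_right_injective₀ ha0).injOn
  rintro _ ⟨g, ⟨hg, hB⟩, rfl⟩
  obtain ⟨z, hz⟩ := h g hg
  refine ⟨?_, fun φ => ?_⟩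
  · rw [Algebra.smul_def] at hz
    change IsIntegral ℤ (algebraMap (𝓞 F) F a * g)
    rw [← hz]
    exact z.isIntegral_coe
  · rw [map_mul, norm_mul]
    refine mul_le_mul (Finset.single_le_sum (f := fun φ : F →+* ℂ => ‖φ (algebraMap (𝓞 F) F a)‖)
      (fun _ _ => norm_nonneg _) (Finset.mem_univ φ)) ?_ (norm_nonneg _)
      (Finset.sum_nonneg fun _ _ => norm_nonneg _)
    simpa using hB (InfinitePlace.mk φ)

/-- A lattice vector that minimizes the weighted maximum norm is minimal, and by Minkowski's theorem
its norm is at most the `2n`-th root of `|Δ_F|`. -/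
lemma exists_isMinimal_log_le (J : (FractionalIdeal (𝓞 F)⁰ F)ˣ) (x : InfinitePlace F → ℝ)
    (hx : ∑ σ : InfinitePlace F, (σ.mult : ℝ) * x σ = Module.finrank ℚ F * logNorm J) :
    ∃ f : Fˣ, IsMinimal (J : FractionalIdeal (𝓞 F)⁰ F) f ∧ ∀ σ : InfinitePlace F,
      Real.log (σ (f : F)) - x σ ≤ Real.log |(discr F : ℝ)| / (2 * Module.finrank ℚ F) := by
  set c := Real.log |(discr F : ℝ)| / (2 * Module.finrank ℚ F) with hc
  have hn : (0 : ℝ) < Module.finrank ℚ F := Nat.cast_pos.2 Module.finrank_pos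
  -- The strict inequality in Minkowski's theorem costs an arbitrarily small `ε`, which the choice
  -- of a minimizer removes.
  have hmink : ∀ ε > 0, ∃ g ∈ (J : FractionalIdeal (𝓞 F)⁰ F), g ≠ 0 ∧
      ∀ σ : InfinitePlace F, Real.log (σ g) - x σ ≤ c + ε := by
    intro ε hε
    obtain ⟨g, hg, hg0, h⟩ := exists_mem_place_lt_exp J (fun σ => x σ + (c + ε)) (by
      simp only [mul_add, Finset.sum_add_distrib, hx, ← Finset.sum_mul, sum_mult_eq_finrank]
      have : Module.finrank ℚ F * c = Real.log |(discr F : ℝ)| / 2 := by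
        rw [hc]; field_simp
      nlinarith)
    refine ⟨g, hg, hg0, fun σ => ?_⟩
    have := (Real.log_lt_iff_lt_exp (place_pos hg0 σ)).2 (h σ)
    linarith
  set m : F → ℝ := fun g => Finset.univ.sup' Finset.univ_nonempty
    fun σ : InfinitePlace F => Real.log (σ g) - x σ with hm
  set S : Set F := {g | g ∈ (J : FractionalIdeal (𝓞 F)⁰ F) ∧ g ≠ 0 ∧ m g ≤ c + 1} with hS
  have hm_le : ∀ g r, m g ≤ r ↔ ∀ σ : InfinitePlace F, Real.log (σ g) - x σ ≤ r := by
    intro g r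
    simp [hm]
  have hfin : S.Finite := by
    refine (finite_mem_place_le (J : FractionalIdeal (𝓞 F)⁰ F)
      (∑ σ : InfinitePlace F, Real.exp (c + 1 + x σ))).subset ?_
    rintro g ⟨hg, hg0, hgm⟩
    refine ⟨hg, fun σ => ?_⟩
    have := (hm_le _ _).1 hgm σ
    refine le_trans ((Real.log_le_iff_le_exp (place_pos hg0 σ)).1 (by linarith :
      Real.log (σ g) ≤ c + 1 + x σ)) ?_
    exact Finset.single_le_sum (f := fun σ : InfinitePlace F => Real.exp (c + 1 + x σ))
      (fun _ _ => (Real.exp_pos _).le) (Finset.mem_univ σ)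
  obtain ⟨g₁, hg₁, hg₁0, h₁⟩ := hmink 1 one_pos
  obtain ⟨f, ⟨hf, hf0, hfm⟩, hmin⟩ := Set.exists_min_image S m hfin
    ⟨g₁, hg₁, hg₁0, (hm_le _ _).2 h₁⟩
  have hmin' : ∀ g ∈ (J : FractionalIdeal (𝓞 F)⁰ F), g ≠ 0 → m f ≤ m g := by
    intro g hg hg0
    by_cases h : m g ≤ c + 1
    · exact hmin g ⟨hg, hg0, h⟩
    · exact hfm.trans (not_le.1 h).le
  refine ⟨Units.mk0 f hf0, ⟨hf, hf0, fun g hg hlt => ?_⟩, ?_⟩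
  · by_contra hg0
    refine (hmin' g hg hg0).not_gt ?_
    simp only [hm, Finset.sup'_lt_iff, Finset.mem_univ, true_implies]
    intro σ
    refine lt_of_lt_of_le (sub_lt_sub_right (Real.log_lt_log (place_pos hg0 σ) (hlt σ)) _) ?_
    exact Finset.le_sup' (fun σ : InfinitePlace F => Real.log (σ f) - x σ) (Finset.mem_univ σ)
  · refine (hm_le f c).1 (le_of_forall_pos_le_add fun ε hε => ?_)
    obtain ⟨g, hg, hg0, h⟩ := hmink ε hε
    exact (hmin' g hg hg0).trans ((hm_le _ _).2 h)

variable (F) in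
/-- The fractional ideals `I` in which `1` is minimal: those with `d I` reduced. -/
def reducedIdeals : Set (FractionalIdeal (𝓞 F)⁰ F)ˣ :=
  {I | IsMinimal (I : FractionalIdeal (𝓞 F)⁰ F) 1}

/-- The inverse of a fractional ideal that contains `1` is integral. -/
lemma exists_ideal_eq_inv {I : (FractionalIdeal (𝓞 F)⁰ F)ˣ}
    (hI : (1 : F) ∈ (I : FractionalIdeal (𝓞 F)⁰ F)) :
    ∃ K : Ideal (𝓞 F), (K : FractionalIdeal (𝓞 F)⁰ F) = (I⁻¹ : (FractionalIdeal (𝓞 F)⁰ F)ˣ) := by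
  have h1 : (1 : FractionalIdeal (𝓞 F)⁰ F) ≤ I := FractionalIdeal.one_le.2 hI
  have h2 : ((I⁻¹ : (FractionalIdeal (𝓞 F)⁰ F)ˣ) : FractionalIdeal (𝓞 F)⁰ F) ≤ 1 := by
    have := mul_le_mul_right h1 ((I⁻¹ : (FractionalIdeal (𝓞 F)⁰ F)ˣ) : FractionalIdeal (𝓞 F)⁰ F)
    rwa [mul_one, Units.inv_mul] at this
  exact FractionalIdeal.le_one_iff_exists_coeIdeal.1 h2

lemma log_absNorm_of_inv_eq {I : (FractionalIdeal (𝓞 F)⁰ F)ˣ} {K : Ideal (𝓞 F)}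
    (hK : (K : FractionalIdeal (𝓞 F)⁰ F) = (I⁻¹ : (FractionalIdeal (𝓞 F)⁰ F)ˣ)) :
    Module.finrank ℚ F * logNorm I = -Real.log (Ideal.absNorm K) := by
  have h : FractionalIdeal.absNorm (I : FractionalIdeal (𝓞 F)⁰ F) * Ideal.absNorm K = 1 := by
    rw [← FractionalIdeal.coeIdeal_absNorm (K := F), hK, ← map_mul, Units.mul_inv, map_one]
  have h' : (FractionalIdeal.absNorm (I : FractionalIdeal (𝓞 F)⁰ F) : ℝ) =
      ((Ideal.absNorm K : ℝ))⁻¹ :=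
    eq_inv_of_mul_eq_one_left (by exact_mod_cast h)
  rw [finrank_mul_logNorm, h', Real.log_inv]

lemma logNorm_nonpos {I : (FractionalIdeal (𝓞 F)⁰ F)ˣ}
    (hI : (1 : F) ∈ (I : FractionalIdeal (𝓞 F)⁰ F)) : logNorm I ≤ 0 := by
  obtain ⟨K, hK⟩ := exists_ideal_eq_inv hI
  have h := log_absNorm_of_inv_eq hK
  have hn : (0 : ℝ) < Module.finrank ℚ F := Nat.cast_pos.2 Module.finrank_pos
  have := Real.log_natCast_nonneg (Ideal.absNorm K)
  by_contra! h0
  nlinarith [mul_pos hn h0]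

variable (F) in
lemma finite_reducedIdeals : (reducedIdeals F).Finite := by
  have key : ∀ I ∈ reducedIdeals F, ∃ K : Ideal (𝓞 F),
      (K : FractionalIdeal (𝓞 F)⁰ F) = (I⁻¹ : (FractionalIdeal (𝓞 F)⁰ F)ˣ) ∧
      Ideal.absNorm K ≤ ⌊|(discr F : ℝ)|⌋₊ := by
    intro I hI
    obtain ⟨K, hK⟩ := exists_ideal_eq_inv hI.1
    refine ⟨K, hK, Nat.le_floor ?_⟩
    have hlog := log_absNorm_of_inv_eq hK
    have h : Real.log (Ideal.absNorm K) ≤ Real.log |(discr F : ℝ)| / 2 := by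
      by_contra! hlt
      obtain ⟨g, hg, hg0, h⟩ := exists_mem_place_lt_exp I (fun _ => 0) (by
        rw [hlog]; simp only [mul_zero, Finset.sum_const_zero]; linarith)
      exact hg0 (hI.2.2 g hg (by simpa using h))
    have hD : 1 ≤ |(discr F : ℝ)| := by
      exact_mod_cast Int.one_le_abs (discr_ne_zero F)
    have h1 : Real.log (Ideal.absNorm K) ≤ Real.log |(discr F : ℝ)| := by
      linarith [Real.log_nonneg hD]
    by_contra! hlt
    exact h1.not_gt (Real.log_lt_log abs_discr_pos hlt)
  choose! K hK hKn using key
  refine Set.Finite.of_finite_image (f := K)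
    ((Ideal.finite_setOfPred_absNorm_le ⌊|(discr F : ℝ)|⌋₊).subset ?_) ?_
  · rintro _ ⟨I, hI, rfl⟩
    exact hKn I hI
  · intro I hI I' hI' h
    refine inv_injective (Units.ext ?_)
    rw [← hK I hI, ← hK I' hI', h]

/-- A vector of degree zero whose coordinates are at least `-c` has norm at most `n c`: it lies in
a simplex whose vertices have at most that norm. -/
lemma norm_le_of_neg_le {b : InfDivisor F} (hb : degInf F b = 0) {c : ℝ}
    (h : ∀ σ, -c ≤ b σ) : ‖b‖ ≤ Module.finrank ℚ F * c := by
  set L := Module.finrank ℚ F * c with hL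
  have hsum : ∑ σ : InfinitePlace F, (σ.mult : ℝ) * (b σ + c) = L := by
    rw [degInf_apply] at hb
    simp only [mul_add, Finset.sum_add_distrib, hb, ← Finset.sum_mul, sum_mult_eq_finrank, zero_add]
    rfl
  have hpos : ∀ σ : InfinitePlace F, 0 ≤ (σ.mult : ℝ) * (b σ + c) := fun σ =>
    mul_nonneg (Nat.cast_nonneg _) (by linarith [h σ])
  have hL0 : 0 ≤ L := hsum ▸ Finset.sum_nonneg fun σ _ => hpos σ
  have hle : ∀ σ : InfinitePlace F, b σ + c ≤ L := by
    intro σ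
    have h1 : (σ.mult : ℝ) * (b σ + c) ≤ L := hsum ▸ Finset.single_le_sum
      (f := fun σ : InfinitePlace F => (σ.mult : ℝ) * (b σ + c)) (fun τ _ => hpos τ)
      (Finset.mem_univ σ)
    have : (1 : ℝ) ≤ σ.mult := by exact_mod_cast InfinitePlace.one_le_mult
    nlinarith [h σ]
  refine abs_le_of_sq_le_sq' ?_ hL0 |>.2
  rw [InfDivisor.norm_sq_eq]
  have h1 : ∑ σ : InfinitePlace F, (σ.mult : ℝ) * (b σ + c) ^ 2 ≤ L * L := by
    calc _ ≤ ∑ σ : InfinitePlace F, (σ.mult : ℝ) * (b σ + c) * L := by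
          refine Finset.sum_le_sum fun σ _ => ?_
          nlinarith [mul_le_mul_of_nonneg_left (hle σ) (hpos σ)]
      _ = L * L := by rw [← Finset.sum_mul, hsum]
  have h2 : ∑ σ : InfinitePlace F, (σ.mult : ℝ) * (b σ + c) ^ 2 =
      ∑ σ : InfinitePlace F, (σ.mult : ℝ) * b σ ^ 2 + L * c := by
    have : ∀ σ : InfinitePlace F, (σ.mult : ℝ) * (b σ + c) ^ 2 =
        (σ.mult : ℝ) * b σ ^ 2 + (2 * c * ((σ.mult : ℝ) * b σ) + c ^ 2 * σ.mult) := fun σ => by ring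
    rw [Finset.sum_congr rfl fun σ _ => this σ, Finset.sum_add_distrib, Finset.sum_add_distrib,
      ← Finset.mul_sum, ← Finset.mul_sum, ← degInf_apply, hb, sum_mult_eq_finrank, hL]
    ring
  have h3 : 0 ≤ L * c := by
    rw [hL]
    nlinarith [mul_self_nonneg c, (Nat.cast_nonneg _ : (0 : ℝ) ≤ Module.finrank ℚ F),
      mul_nonneg (Nat.cast_nonneg _ : (0 : ℝ) ≤ Module.finrank ℚ F) (mul_self_nonneg c)]
  linarith [pow_two L]

/-- Every point of the Arakelov class group is within distance `(1/2) log |Δ_F|` of the class of a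
reduced ideal. -/
lemma exists_reduced_near (P : Pic0 F) : ∃ I ∈ reducedIdeals F, ∃ b : InfDivisor0 F,
    ‖b‖ ≤ Real.log |(discr F : ℝ)| / 2 ∧ idealClass I + toPic F b = P := by
  obtain ⟨E, rfl⟩ := QuotientAddGroup.mk_surjective P
  obtain ⟨J, hJ⟩ := exists_ideal_of_divisor E
  have hdeg := degInf_eq_logNorm hJ
  obtain ⟨f, hf, hfle⟩ := exists_isMinimal_log_le J (E : ArakelovDivisor F).2 hdeg
  have hfinv : FractionalIdeal.spanSingleton (𝓞 F)⁰ (f : F) *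
      FractionalIdeal.spanSingleton (𝓞 F)⁰ ((f⁻¹ : Fˣ) : F) = 1 := by
    rw [FractionalIdeal.spanSingleton_mul_spanSingleton, Units.mul_inv,
      FractionalIdeal.spanSingleton_one]
  set I : (FractionalIdeal (𝓞 F)⁰ F)ˣ := Units.mk0
    (FractionalIdeal.spanSingleton (𝓞 F)⁰ ((f⁻¹ : Fˣ) : F) * J)
    (mul_ne_zero (spanSingleton_unit_ne_zero _) J.ne_zero) with hIdef
  have hJI : (J : FractionalIdeal (𝓞 F)⁰ F) =
      FractionalIdeal.spanSingleton (𝓞 F)⁰ (f : F) * (I : FractionalIdeal (𝓞 F)⁰ F) := by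
    rw [hIdef, Units.val_mk0, ← mul_assoc, hfinv, one_mul]
  have hmem : ∀ g, g ∈ (I : FractionalIdeal (𝓞 F)⁰ F) ↔
      (f : F) * g ∈ (J : FractionalIdeal (𝓞 F)⁰ F) := by
    intro g
    rw [hJI, FractionalIdeal.mem_singleton_mul]
    constructor
    · exact fun h => ⟨g, h, rfl⟩
    · rintro ⟨g', hg', h⟩
      rwa [mul_left_cancel₀ f.ne_zero h]
  have hI : I ∈ reducedIdeals F := by
    refine ⟨by rw [hmem, mul_one]; exact hf.1, one_ne_zero, fun g hg hlt => ?_⟩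
    have := hf.2.2 _ ((hmem g).1 hg) fun σ => by
      rw [map_mul]
      have h1 := hlt σ
      rw [map_one] at h1
      exact mul_lt_of_lt_one_right (place_pos f.ne_zero σ) h1
    exact (mul_eq_zero.1 this).resolve_left f.ne_zero
  have hlog : Module.finrank ℚ F * logNorm J =
      ∑ σ : InfinitePlace F, (σ.mult : ℝ) * Real.log (σ (f : F)) +
        Module.finrank ℚ F * logNorm I := by
    rw [finrank_mul_logNorm, finrank_mul_logNorm, hJI, map_mul, Rat.cast_mul,
      Real.log_mul (absNorm_pos (spanSingleton_unit_ne_zero f)).ne' (absNorm_pos I.ne_zero).ne',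
      log_absNorm_spanSingleton]
  set b : InfDivisor F := fun σ => (E : ArakelovDivisor F).2 σ - Real.log (σ (f : F)) - logNorm I
    with hb
  have hb0 : degInf F b = 0 := by
    rw [degInf_apply] at hdeg ⊢
    simp only [hb, mul_sub, Finset.sum_sub_distrib, ← Finset.sum_mul, sum_mult_eq_finrank]
    linarith
  refine ⟨I, hI, ⟨b, hb0⟩, ?_, (idealClass_add_toPic_eq_iff hJ I _).2 ⟨f, hJI, fun σ => ?_⟩⟩
  · have hle := norm_le_of_neg_le hb0 (c := Real.log |(discr F : ℝ)| / (2 * Module.finrank ℚ F))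
      fun σ => by
        have h1 := hfle σ
        have h2 := logNorm_nonpos hI.1
        simp only [hb]
        linarith
    have hn : (Module.finrank ℚ F : ℝ) ≠ 0 := Nat.cast_ne_zero.2 Module.finrank_pos.ne'
    refine hle.trans_eq ?_
    field_simp
  · change logNorm I + ((E : ArakelovDivisor F).2 σ - Real.log (σ (f : F)) - logNorm I) = _
    ring

end Minkowski

/-! ### Sectors of the plane -/

section Octants

/-- The sector of angle `π/4` that contains `z`, encoded by the signs of the real and of the
imaginary part and by which of the two is larger in absolute value. -/
def octant (z : ℂ) : Bool × Bool × Bool :=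
  (decide (0 ≤ z.re), decide (0 ≤ z.im), decide (|z.re| ≤ |z.im|))

/-- The cosine of the angle between two vectors of the same sector is at least `1/√2`, so
`|w - z|² ≤ |z|² - |w| (√2 |z| - |w|)`. -/
lemma norm_sub_lt_of_octant_eq {z w : ℂ} (h : octant z = octant w) (hw : w ≠ 0)
    (hlt : ‖w‖ ^ 2 < 2 * ‖z‖ ^ 2) : ‖w - z‖ < ‖z‖ := by
  simp only [octant, Prod.mk.injEq, decide_eq_decide] at h
  obtain ⟨h1, h2, h3⟩ := h
  have hre : 0 ≤ z.re * w.re := by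
    by_cases h : 0 ≤ z.re
    · exact mul_nonneg h (h1.1 h)
    · exact mul_nonneg_of_nonpos_of_nonpos (not_le.1 h).le (not_le.1 (h1.not.1 h)).le
  have him : 0 ≤ z.im * w.im := by
    by_cases h : 0 ≤ z.im
    · exact mul_nonneg h (h2.1 h)
    · exact mul_nonneg_of_nonpos_of_nonpos (not_le.1 h).le (not_le.1 (h2.not.1 h)).le
  have hsq : 0 ≤ (z.im ^ 2 - z.re ^ 2) * (w.im ^ 2 - w.re ^ 2) := by
    rw [← sq_le_sq, ← sq_le_sq] at h3
    by_cases h : z.re ^ 2 ≤ z.im ^ 2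
    · exact mul_nonneg (sub_nonneg.2 h) (sub_nonneg.2 (h3.1 h))
    · exact mul_nonneg_of_nonpos_of_nonpos (sub_nonpos.2 (not_le.1 h).le)
        (sub_nonpos.2 (not_le.1 (h3.not.1 h)).le)
  have nz : ‖z‖ ^ 2 = z.re ^ 2 + z.im ^ 2 := by
    rw [Complex.sq_norm, Complex.normSq_apply]; ring
  have nw : ‖w‖ ^ 2 = w.re ^ 2 + w.im ^ 2 := by
    rw [Complex.sq_norm, Complex.normSq_apply]; ring
  have nwz : ‖w - z‖ ^ 2 = (w.re - z.re) ^ 2 + (w.im - z.im) ^ 2 := by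
    rw [Complex.sq_norm, Complex.normSq_apply, Complex.sub_re, Complex.sub_im]; ring
  set p := z.re * w.re + z.im * w.im with hp
  have hp0 : 0 ≤ p := add_nonneg hre him
  have hp2 : ‖z‖ ^ 2 * ‖w‖ ^ 2 ≤ 2 * p ^ 2 := by
    have := mul_nonneg hre him
    rw [nz, nw, hp]
    linarith
  have hw0 : 0 < ‖w‖ ^ 2 := by positivity
  have hwp : ‖w‖ ^ 2 < 2 * p := by
    refine lt_of_pow_lt_pow_left₀ 2 (by positivity) ?_
    nlinarith [mul_lt_mul_of_pos_left hlt hw0]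
  refine lt_of_pow_lt_pow_left₀ 2 (norm_nonneg _) ?_
  rw [nwz, nz]
  rw [nw] at hwp
  linarith

lemma octant_ofReal {z : ℂ} (hz : z ≠ 0) (him : z.im = 0) :
    octant z = (decide (0 ≤ z.re), true, false) := by
  have : z.re ≠ 0 := fun h => hz (Complex.ext h him)
  simp [octant, him, this]

end Octants

/-! ### Packing: reduced ideals near a given point -/

section Packing

variable {F : Type*} [Field F] [NumberField F]

variable (F) in
/-- For each infinite place the sign of a real part, and at a complex place also the remaining two
bits of an octant. -/
abbrev Cell : Type _ :=
  (InfinitePlace F → Bool) × ({σ : InfinitePlace F // σ.IsComplex} → Bool × Bool)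

/-- The signs of `f` at the real places and the octants of `f` at the complex places. -/
def cell (f : F) : Cell F :=
  (fun σ => (octant (σ.embedding f)).1, fun σ => (octant (σ.1.embedding f)).2)

lemma octant_eq_of_cell_eq {F : Type*} [Field F] {f g : F} (hf : f ≠ 0) (hg : g ≠ 0)
    (h : cell f = cell g) (σ : InfinitePlace F) :
    octant (σ.embedding f) = octant (σ.embedding g) := by
  have h1 : (octant (σ.embedding f)).1 = (octant (σ.embedding g)).1 :=
    congrFun (congrArg Prod.fst h) σ
  by_cases hσ : σ.IsComplex
  · exact Prod.ext h1 (congrFun (congrArg Prod.snd h) ⟨σ, hσ⟩)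
  · have hreal : ∀ x : F, (σ.embedding x).im = 0 := fun x =>
      Complex.conj_eq_iff_im.1 (RingHom.congr_fun
        (InfinitePlace.isReal_iff.1 (InfinitePlace.not_isComplex_iff_isReal.1 hσ)) x)
    have hf' := octant_ofReal (by simpa using hf) (hreal f)
    have hg' := octant_ofReal (by simpa using hg) (hreal g)
    refine Prod.ext h1 ?_
    rw [hf', hg']

lemma card_cell : ENat.card (Cell F) =
    (2 ^ Fintype.card (InfinitePlace F) * 4 ^ InfinitePlace.nrComplexPlaces F : ℕ) := by
  classical
  rw [ENat.card_eq_coe_fintype_card]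
  simp [InfinitePlace.nrComplexPlaces]

/-- If `f` and `g` lie in the same cell and `|σ(g)| < √2 |σ(f)|` for all `σ`, then
`|σ(g - f)| < |σ(f)|` for all `σ`, which the minimality of `f` forbids unless `f = g`. -/
lemma eq_of_cell_eq {J : FractionalIdeal (𝓞 F)⁰ F} {f g : F} (hf : IsMinimal J f) (hg : g ∈ J)
    (hg0 : g ≠ 0) (h : cell f = cell g)
    (hlt : ∀ σ : InfinitePlace F, Real.log (σ g) < Real.log (σ f) + Real.log 2 / 2) : f = g := by
  refine (sub_eq_zero.1 (hf.2.2 (g - f) ?_ fun σ => ?_)).symm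
  · exact J.val.sub_mem hg hf.1
  · rw [← InfinitePlace.norm_embedding_eq σ f, ← InfinitePlace.norm_embedding_eq σ (g - f), map_sub]
    refine norm_sub_lt_of_octant_eq (octant_eq_of_cell_eq hf.2.1 hg0 h σ) (by simpa using hg0) ?_
    rw [InfinitePlace.norm_embedding_eq, InfinitePlace.norm_embedding_eq]
    have h1 := place_pos hf.2.1 σ
    have h2 := place_pos hg0 σ
    rw [← Real.log_lt_log_iff (by positivity) (by positivity),
      Real.log_mul (by norm_num) (by positivity), Real.log_pow, Real.log_pow]
    push_cast
    linarith [hlt σ]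

lemma isMinimal_of_eq_mul {I J : FractionalIdeal (𝓞 F)⁰ F} {f : F} (hf : f ≠ 0)
    (hJ : J = FractionalIdeal.spanSingleton (𝓞 F)⁰ f * I) (h1 : IsMinimal I 1) : IsMinimal J f := by
  refine ⟨?_, hf, fun g hg hlt => ?_⟩
  · rw [hJ, FractionalIdeal.mem_singleton_mul]
    exact ⟨1, h1.1, (mul_one f).symm⟩
  · rw [hJ, FractionalIdeal.mem_singleton_mul] at hg
    obtain ⟨g', hg', rfl⟩ := hg
    rw [h1.2.2 g' hg' fun σ => ?_, mul_zero]
    have := hlt σ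
    rw [map_mul] at this
    rw [map_one]
    exact (mul_lt_iff_lt_one_right (place_pos hf σ)).1 this

/-- The number of representations of a point as `[I] + [b]`, with `I` reduced and `b` small, is
bounded by the number of cells. -/
lemma encard_reduced_near_le (P : Pic0 F) :
    {p : (FractionalIdeal (𝓞 F)⁰ F)ˣ × InfDivisor0 F | p.1 ∈ reducedIdeals F ∧
      ‖p.2‖ < Real.log 2 / 4 ∧ idealClass p.1 + toPic F p.2 = P}.encard ≤
      (2 ^ Fintype.card (InfinitePlace F) * 4 ^ InfinitePlace.nrComplexPlaces F : ℕ) := by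
  obtain ⟨E, rfl⟩ := QuotientAddGroup.mk_surjective P
  obtain ⟨J, hJ⟩ := exists_ideal_of_divisor E
  set S := {p : (FractionalIdeal (𝓞 F)⁰ F)ˣ × InfDivisor0 F | p.1 ∈ reducedIdeals F ∧
    ‖p.2‖ < Real.log 2 / 4 ∧ idealClass p.1 + toPic F p.2 = QuotientAddGroup.mk E}
  have hex : ∀ p : S, ∃ f : Fˣ, (J : FractionalIdeal (𝓞 F)⁰ F) =
      FractionalIdeal.spanSingleton (𝓞 F)⁰ (f : F) * (p.1.1 : FractionalIdeal (𝓞 F)⁰ F) ∧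
        ∀ σ : InfinitePlace F, logNorm p.1.1 + (p.1.2 : InfDivisor F) σ =
          (E : ArakelovDivisor F).2 σ - Real.log (σ (f : F)) := fun p =>
    (idealClass_add_toPic_eq_iff hJ p.1.1 p.1.2).1 p.2.2.2
  choose f hf hfE using hex
  have hmin : ∀ p : S, IsMinimal (J : FractionalIdeal (𝓞 F)⁰ F) (f p) := fun p =>
    isMinimal_of_eq_mul (f p).ne_zero (hf p) p.2.1
  have hb : ∀ (p : S) (σ : InfinitePlace F), |(p.1.2 : InfDivisor F) σ| < Real.log 2 / 4 :=
    fun p σ => (InfDivisor.abs_apply_le_norm _ σ).trans_lt p.2.2.1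
  -- `f p` and `f q` have the logarithmic sizes `-logNorm p.1.1` and `-logNorm q.1.1`, up to errors
  -- less than `(log 2)/4`; minimality is used for the larger one.
  have hle : ∀ p q : S, logNorm p.1.1 ≤ logNorm q.1.1 → cell (f p : F) = cell (f q : F) →
      f p = f q := by
    intro p q hpq hc
    refine Units.ext (eq_of_cell_eq (hmin p) (hmin q).1 (f q).ne_zero hc fun σ => ?_)
    have h1 := abs_lt.1 (hb p σ)
    have h2 := abs_lt.1 (hb q σ)
    linarith [hfE p σ, hfE q σ]
  have hinj : Function.Injective fun p : S => cell (f p : F) := by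
    intro p q hpq
    have heq : f p = f q := by
      rcases le_total (logNorm p.1.1) (logNorm q.1.1) with h | h
      · exact hle p q h hpq
      · exact (hle q p h hpq.symm).symm
    have hI : p.1.1 = q.1.1 := by
      have h := (hf p).symm.trans (hf q)
      rw [heq] at h
      exact Units.ext (mul_left_cancel₀ (spanSingleton_unit_ne_zero _) h)
    refine Subtype.ext (Prod.ext hI (Subtype.ext (funext fun σ => ?_)))
    have h1 := hfE p σ
    have h2 := hfE q σ
    rw [hI, heq] at h1
    linarith
  have h := ENat.card_le_card_of_injective hinj
  rwa [ENat.card_coe_set_eq, card_cell] at h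

end Packing

/-! ### The logarithmic unit lattice -/

section UnitLattice

open NumberField.Units NumberField.Units.dirichletUnitTheorem

variable {F : Type*} [Field F] [NumberField F]

lemma ext_of_eq_off_w₀ {x y : InfDivisor0 F}
    (h : ∀ σ : InfinitePlace F, σ ≠ w₀ → (x : InfDivisor F) σ = (y : InfDivisor F) σ) : x = y := by
  classical
  have hdeg : ∑ σ : InfinitePlace F, (σ.mult : ℝ) * ((x : InfDivisor F) σ - (y : InfDivisor F) σ)
      = 0 := (x - y).2
  rw [Finset.sum_eq_single w₀ (fun σ _ hσ => by rw [h σ hσ, sub_self, mul_zero])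
    (fun h => absurd (Finset.mem_univ _) h)] at hdeg
  have h0 : (x : InfDivisor F) w₀ = (y : InfDivisor F) w₀ := sub_eq_zero.1
    ((mul_eq_zero.1 hdeg).resolve_left (Nat.cast_ne_zero.2 InfinitePlace.mult_ne_zero))
  refine Subtype.ext (funext fun σ => ?_)
  by_cases hσ : σ = w₀
  · rw [hσ, h0]
  · exact h σ hσ

variable (F) in
/-- The coordinates on the tangent space used in Mathlib for the logarithms of units: one place is
dropped and the others are weighted by their degrees. -/
def toLogSpace : InfDivisor0 F ≃ₗ[ℝ] logSpace F :=
  LinearEquiv.ofBijective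
    ({ toFun := fun x (w : {w : InfinitePlace F // w ≠ w₀}) =>
         (w.1.mult : ℝ) * (x : InfDivisor F) w.1
       map_add' := fun x y => funext fun w => mul_add _ _ _
       map_smul' := fun r x => funext fun w => mul_left_comm _ _ _ } :
      InfDivisor0 F →ₗ[ℝ] logSpace F) (by
    classical
    constructor
    · intro x y h
      refine ext_of_eq_off_w₀ fun σ hσ => ?_
      exact mul_left_cancel₀ (Nat.cast_ne_zero.2 InfinitePlace.mult_ne_zero) (congrFun h ⟨σ, hσ⟩)
    · intro y
      set z : InfDivisor F := fun σ => if h : σ ≠ w₀ then y ⟨σ, h⟩ / σ.mult else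
        -(∑ w, y w) / σ.mult with hz
      have hz1 : ∀ w : {w : InfinitePlace F // w ≠ w₀}, (w.1.mult : ℝ) * z w.1 = y w := by
        intro w
        have : (w.1.mult : ℝ) ≠ 0 := Nat.cast_ne_zero.2 InfinitePlace.mult_ne_zero
        simp only [hz, dif_pos w.2]
        field_simp
      have hz0 : ((w₀ : InfinitePlace F).mult : ℝ) * z w₀ = -∑ w, y w := by
        have : ((w₀ : InfinitePlace F).mult : ℝ) ≠ 0 :=
          Nat.cast_ne_zero.2 InfinitePlace.mult_ne_zero
        simp only [hz, ne_eq, not_true_eq_false, dite_false]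
        field_simp
      refine ⟨⟨z, ?_⟩, funext hz1⟩
      rw [LinearMap.mem_ker, degInf_apply, Fintype.sum_eq_add_sum_subtype_ne _ w₀, hz0,
        Finset.sum_congr rfl fun w _ => hz1 w]
      ring)

lemma toLogSpace_apply (x : InfDivisor0 F) (w : {w : InfinitePlace F // w ≠ w₀}) :
    toLogSpace F x w = (w.1.mult : ℝ) * (x : InfDivisor F) w.1 := rfl

lemma toPic_eq_zero_iff (x : InfDivisor0 F) : toPic F x = 0 ↔ ∃ f : Fˣ,
    FractionalIdeal.spanSingleton (𝓞 F)⁰ (f : F) = 1 ∧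
      ∀ σ : InfinitePlace F, (x : InfDivisor F) σ = -Real.log (σ (f : F)) := by
  rw [toPic_apply, ← QuotientAddGroup.mk_zero, mk_eq_mk_iff]
  refine exists_congr fun f => ?_
  have h1 : idealDivisor (1 : FractionalIdeal (𝓞 F)⁰ F) = 0 :=
    Finsupp.ext fun p => FractionalIdeal.count_one F p
  rw [AddSubgroup.coe_zero, zero_add]
  constructor
  · intro h
    refine ⟨idealDivisor_injective (spanSingleton_unit_ne_zero f) one_ne_zero ?_,
      fun σ => congrFun (congrArg Prod.snd h) σ⟩
    rw [h1]
    exact (congrArg Prod.fst h).symm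
  · rintro ⟨hf, hx⟩
    refine Prod.ext ?_ (funext hx)
    rw [principal_fst, hf, h1]
    rfl

/-- The kernel of `toPic` consists of the logarithms of units. -/
lemma toPic_eq_zero_iff_mem_unitLattice (x : InfDivisor0 F) :
    toPic F x = 0 ↔ toLogSpace F x ∈ unitLattice F := by
  rw [toPic_eq_zero_iff]
  constructor
  · rintro ⟨f, hf, hx⟩
    have hfmem : (f : F) ∈ (1 : FractionalIdeal (𝓞 F)⁰ F) :=
      hf ▸ FractionalIdeal.mem_spanSingleton_self (𝓞 F)⁰ (f : F)
    have hfinv : FractionalIdeal.spanSingleton (𝓞 F)⁰ ((f⁻¹ : Fˣ) : F) = 1 := by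
      rw [← one_mul (FractionalIdeal.spanSingleton (𝓞 F)⁰ ((f⁻¹ : Fˣ) : F)), ← hf,
        FractionalIdeal.spanSingleton_mul_spanSingleton, Units.mul_inv,
        FractionalIdeal.spanSingleton_one, hf]
    have hgmem : ((f⁻¹ : Fˣ) : F) ∈ (1 : FractionalIdeal (𝓞 F)⁰ F) :=
      hfinv ▸ FractionalIdeal.mem_spanSingleton_self (𝓞 F)⁰ ((f⁻¹ : Fˣ) : F)
    obtain ⟨a, ha⟩ := (FractionalIdeal.mem_one_iff _).1 hfmem
    obtain ⟨b, hb⟩ := (FractionalIdeal.mem_one_iff _).1 hgmem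
    have hab : a * b = 1 := FaithfulSMul.algebraMap_injective (𝓞 F) F (by
      rw [map_mul, ha, hb, Units.mul_inv, map_one])
    refine ⟨Additive.ofMul (Units.mkOfMulEqOne b a (by rw [mul_comm, hab])), trivial, ?_⟩
    funext w
    rw [toLogSpace_apply, hx]
    change (w.1.mult : ℝ) * Real.log (w.1 (algebraMap (𝓞 F) F b)) = _
    rw [hb, Units.val_inv_eq_inv_val, map_inv₀, Real.log_inv]
  · rintro ⟨ε, -, hε⟩
    obtain ⟨u, rfl⟩ := Additive.ofMul.surjective ε
    have huinv : algebraMap (𝓞 F) F ((u⁻¹ : (𝓞 F)ˣ) : 𝓞 F) * algebraMap (𝓞 F) F (u : 𝓞 F) = 1 := by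
      rw [← map_mul, Units.inv_mul, map_one]
    refine ⟨Units.mkOfMulEqOne _ _ huinv, ?_, ?_⟩
    · refine le_antisymm ?_ ?_
      · rw [FractionalIdeal.spanSingleton_le_iff_mem, FractionalIdeal.mem_one_iff]
        exact ⟨_, rfl⟩
      · rw [FractionalIdeal.one_le, FractionalIdeal.mem_spanSingleton]
        exact ⟨u, by rw [Algebra.smul_def, mul_comm]; exact huinv⟩
    · have hval : ∀ σ : InfinitePlace F, -Real.log (σ (algebraMap (𝓞 F) F ((u⁻¹ : (𝓞 F)ˣ) : 𝓞 F))) =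
          Real.log (σ (algebraMap (𝓞 F) F (u : 𝓞 F))) := by
        intro σ
        rw [eq_inv_of_mul_eq_one_left huinv, map_inv₀, Real.log_inv, neg_neg]
      have hy : degInf F (fun σ => Real.log (σ (algebraMap (𝓞 F) F (u : 𝓞 F))) :
          InfinitePlace F → ℝ) = 0 := sum_mult_mul_log u
      have hxy : x = ⟨_, hy⟩ := ext_of_eq_off_w₀ fun σ hσ => by
        have : (σ.mult : ℝ) * Real.log (σ (algebraMap (𝓞 F) F (u : 𝓞 F))) =
          σ.mult * (x : InfDivisor F) σ := congrFun hε ⟨σ, hσ⟩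
        exact (mul_left_cancel₀ (Nat.cast_ne_zero.2 InfinitePlace.mult_ne_zero) this).symm
      intro σ
      rw [hxy]
      exact (hval σ).symm

variable (F) in
/-- The tangent space has a basis that generates the lattice of logarithms of units. -/
lemma exists_basis_ker_toPic : ∃ B : Module.Basis (Fin (rank F)) ℝ (InfDivisor0 F),
    ∀ x, x ∈ Submodule.span ℤ (Set.range B) ↔ toPic F x = 0 := by
  classical
  refine ⟨((basisUnitLattice F).ofZLatticeBasis ℝ (unitLattice F)).map (toLogSpace F).symm,
    fun x => ?_⟩
  rw [← ZSpan.map, Module.Basis.ofZLatticeBasis_span, toPic_eq_zero_iff_mem_unitLattice]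
  constructor
  · rintro ⟨y, hy, rfl⟩
    simpa using hy
  · exact fun h => ⟨_, h, by simp⟩

variable (F) in
lemma finrank_infDivisor0 : Module.finrank ℝ (InfDivisor0 F) = rank F := by
  obtain ⟨B, -⟩ := exists_basis_ker_toPic F
  rw [Module.finrank_eq_card_basis B, Fintype.card_fin]

instance : (euclideanVolume F).IsAddHaarMeasure := by
  unfold euclideanVolume
  infer_instance

instance : Countable (toPic F).ker := by
  obtain ⟨B, hB⟩ := exists_basis_ker_toPic F
  have : Countable (Submodule.span ℤ (Set.range B)) := inferInstance
  exact (Equiv.subtypeEquivRight fun x =>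
    (hB x).trans AddMonoidHom.mem_ker.symm).countable_iff.1 this

variable (F) in
lemma exists_fundamentalDomain : ∃ D : Set (InfDivisor0 F), MeasurableSet D ∧
    ∀ x, ∃! g : (toPic F).ker, g +ᵥ x ∈ D := by
  obtain ⟨B, hB⟩ := exists_basis_ker_toPic F
  refine ⟨ZSpan.fundamentalDomain B, ZSpan.fundamentalDomain_measurableSet B, fun x => ?_⟩
  obtain ⟨g, hg, huniq⟩ := ZSpan.exist_unique_vadd_mem_fundamentalDomain B x
  refine ⟨⟨g, (hB g).1 g.2⟩, hg, fun g' hg' => ?_⟩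
  have h := congrArg Subtype.val (huniq ⟨g', (hB g').2 g'.2⟩ hg')
  exact Subtype.ext h

end UnitLattice

/-! ### Packing and covering modulo a countable group -/

section FundamentalDomain

open scoped Pointwise

variable {G α ι : Type*} [AddGroup G] [Countable G] [AddAction G α] [MeasurableSpace α]
  [MeasurableConstVAdd G α] {μ : Measure α} [VAddInvariantMeasure G α μ] {s : Set α}

/-- If no point lies in more than `M` translates of the sets `T i`, then their total measure is at
most `M` times that of a fundamental domain. -/
lemma tsum_measure_le_mul_of_encard_le [Countable ι] (h : IsAddFundamentalDomain G s μ)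
    {T : ι → Set α} (hT : ∀ i, MeasurableSet (T i)) {M : ℕ}
    (hM : ∀ a, {p : ι × G | a ∈ p.2 +ᵥ T p.1}.encard ≤ M) : ∑' i, μ (T i) ≤ M * μ s := by
  have hmeas : ∀ p : ι × G, MeasurableSet (p.2 +ᵥ T p.1) := fun p => (hT p.1).const_vadd p.2
  calc ∑' i, μ (T i) = ∑' p : ι × G, μ ((p.2 +ᵥ T p.1) ∩ s) := by
        rw [ENNReal.tsum_prod']
        exact tsum_congr fun i => h.measure_eq_tsum (T i)
    _ = ∑' p : ι × G, ∫⁻ a in s, (p.2 +ᵥ T p.1).indicator 1 a ∂μ := by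
        refine tsum_congr fun p => ?_
        rw [lintegral_indicator_one (hmeas p), Measure.restrict_apply (hmeas p)]
    _ = ∫⁻ a in s, ∑' p : ι × G, (p.2 +ᵥ T p.1).indicator 1 a ∂μ :=
        (lintegral_tsum fun p => (measurable_one.indicator (hmeas p)).aemeasurable).symm
    _ ≤ ∫⁻ _ in s, M ∂μ := by
        refine lintegral_mono fun a => ?_
        have : ∑' p : ι × G, (p.2 +ᵥ T p.1).indicator (1 : α → ENNReal) a =
            {p : ι × G | a ∈ p.2 +ᵥ T p.1}.encard := by
          rw [← ENNReal.tsum_set_one, tsum_subtype {p : ι × G | a ∈ p.2 +ᵥ T p.1} fun _ => 1]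
          exact tsum_congr fun p => Set.indicator_const_eq_indicator_const Iff.rfl
        rw [this]
        exact (ENat.toENNReal_le.2 (hM a)).trans_eq (by simp)
    _ = M * μ s := by simp

lemma measure_le_tsum_of_cover (h : IsAddFundamentalDomain G s μ) [Countable ι] {T : ι → Set α}
    (hT : ∀ a, ∃ i, ∃ g : G, a ∈ g +ᵥ T i) : μ s ≤ ∑' i, μ (T i) := by
  have hsub : s ⊆ ⋃ p : ι × G, (p.2 +ᵥ T p.1) ∩ s := fun a ha => by
    obtain ⟨i, g, hg⟩ := hT a
    exact Set.mem_iUnion.2 ⟨(i, g), hg, ha⟩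
  calc μ s ≤ ∑' p : ι × G, μ ((p.2 +ᵥ T p.1) ∩ s) := (measure_mono hsub).trans (measure_iUnion_le _)
    _ = ∑' i, μ (T i) := by
        rw [ENNReal.tsum_prod']
        exact tsum_congr fun i => (h.measure_eq_tsum (T i)).symm

/-- A set that meets every orbit at most once takes up at most as much of an invariant set `T` as a
fundamental domain does. -/
lemma measure_inter_le_of_disjoint_translates (h : IsAddFundamentalDomain G s μ)
    (hs : MeasurableSet s) {A T : Set α} (hA : MeasurableSet A) (hT : MeasurableSet T)
    (hinv : ∀ g : G, g +ᵥ T = T)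
    (hdisj : Pairwise (Function.onFun Disjoint fun g : G => g +ᵥ A)) : μ (A ∩ T) ≤ μ (s ∩ T) := by
  rw [h.measure_eq_tsum (A ∩ T)]
  refine (tsum_meas_le_meas_iUnion_of_disjoint μ (As := fun g : G => (g +ᵥ (A ∩ T)) ∩ s)
    (fun g => ((hA.inter hT).const_vadd g).inter hs) ?_).trans (measure_mono ?_)
  · intro g g' hgg'
    exact (hdisj hgg').mono (Set.inter_subset_left.trans (Set.vadd_set_mono Set.inter_subset_left))
      (Set.inter_subset_left.trans (Set.vadd_set_mono Set.inter_subset_left))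
  · refine Set.iUnion_subset fun g a ha => ⟨ha.2, ?_⟩
    rw [← hinv g]
    exact Set.vadd_set_mono Set.inter_subset_right ha.1

end FundamentalDomain

/-! ### The Riemannian volume -/

section Volume

open scoped Pointwise

variable {F : Type*} [Field F] [NumberField F]

variable (F) in
/-- The group of connected components of the Arakelov class group (the ideal class group). -/
abbrev Components : Type _ := Pic0 F ⧸ (toPic F).range

variable (F) in
/-- A measurable set that contains exactly one point of every coset of the unit lattice. -/
def fundDomain : Set (InfDivisor0 F) := (exists_fundamentalDomain F).choose

lemma measurableSet_fundDomain : MeasurableSet (fundDomain F) :=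
  (exists_fundamentalDomain F).choose_spec.1

lemma exists_unique_vadd_mem_fundDomain (x : InfDivisor0 F) :
    ∃! g : (toPic F).ker, g +ᵥ x ∈ fundDomain F :=
  (exists_fundamentalDomain F).choose_spec.2 x

instance : VAddInvariantMeasure (toPic F).ker (InfDivisor0 F) (euclideanVolume F) :=
  ⟨fun g _ _ => measure_preimage_add _ (g : InfDivisor0 F) _⟩

variable (F) in
lemma isAddFundamentalDomain_fundDomain :
    IsAddFundamentalDomain (toPic F).ker (fundDomain F) (euclideanVolume F) :=
  .mk' measurableSet_fundDomain.nullMeasurableSet exists_unique_vadd_mem_fundDomain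

lemma toPic_vadd (g : (toPic F).ker) (x : InfDivisor0 F) : toPic F (g +ᵥ x) = toPic F x := by
  change toPic F (g + x) = _
  rw [map_add, AddMonoidHom.mem_ker.1 g.2, zero_add]

lemma injOn_chart_fundDomain (P : Pic0 F) : Set.InjOn (chart P) (fundDomain F) := by
  intro x hx y hy h
  rw [chart_eq, chart_eq, add_right_inj] at h
  obtain ⟨g, -, hg⟩ := exists_unique_vadd_mem_fundDomain x
  have h0 : (0 : (toPic F).ker) = g := hg 0 (by simpa using hx)
  have h1 : (⟨y - x, by rw [AddMonoidHom.mem_ker, map_sub, h, sub_self]⟩ : (toPic F).ker) = g :=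
    hg _ (by change y - x + x ∈ _; simpa using hy)
  have h2 := congrArg Subtype.val (h1.trans h0.symm)
  exact (sub_eq_zero.1 h2).symm

lemma measurable_chart (P : Pic0 F) : Measurable (chart P) := (continuous_chart P).measurable

lemma component_add_toPic (P : Pic0 F) (x : InfDivisor0 F) :
    (QuotientAddGroup.mk (P + toPic F x) : Components F) = QuotientAddGroup.mk P :=
  QuotientAddGroup.mk_add_of_mem P (AddMonoidHom.mem_range.2 ⟨x, rfl⟩)

lemma exists_eq_out_add (P : Pic0 F) :
    ∃ x : InfDivisor0 F, P = (QuotientAddGroup.mk P : Components F).out + toPic F x := by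
  have h : (QuotientAddGroup.mk (QuotientAddGroup.mk P : Components F).out : Components F) =
      QuotientAddGroup.mk P := Quotient.out_eq _
  obtain ⟨x, hx⟩ := QuotientAddGroup.eq.1 h
  exact ⟨x, by rw [hx]; abel⟩

variable (F) in
/-- The volume of one component, carried by a fundamental domain of the unit lattice. -/
def componentMeasure (q : Components F) : Measure (Pic0 F) :=
  ((euclideanVolume F).restrict (fundDomain F)).map (chart q.out)

lemma componentMeasure_le (q : Components F) : componentMeasure F q ≤ riemannianVolume F :=
  le_iSup₂_of_le q.out (fundDomain F) <| le_iSup₂_of_le measurableSet_fundDomain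
    (injOn_chart_fundDomain _) le_rfl

/-- Every chart in the definition of the Riemannian volume is dominated by the chart on the
fundamental domain of the same component. -/
lemma map_chart_le_componentMeasure (P : Pic0 F) {A : Set (InfDivisor0 F)} (hA : MeasurableSet A)
    (hinj : Set.InjOn (chart P) A) :
    ((euclideanVolume F).restrict A).map (chart P) ≤
      componentMeasure F (QuotientAddGroup.mk P) := by
  refine Measure.le_iff.2 fun S hS => ?_
  obtain ⟨x, hx⟩ := exists_eq_out_add P
  set P₀ : Pic0 F := (QuotientAddGroup.mk P : Components F).out
  have hT := measurable_chart P₀ hS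
  rw [componentMeasure, Measure.map_apply (measurable_chart _) hS,
    Measure.map_apply (measurable_chart _) hS, Measure.restrict_apply (measurable_chart _ hS),
    Measure.restrict_apply hT]
  have hA' : MeasurableSet ((fun y : InfDivisor0 F => -x + y) ⁻¹' A) := measurable_const_add _ hA
  have heq : chart P ⁻¹' S ∩ A = (fun y : InfDivisor0 F => x + y) ⁻¹'
      (((fun y : InfDivisor0 F => -x + y) ⁻¹' A) ∩ chart P₀ ⁻¹' S) := by
    ext y
    simp only [Set.mem_inter_iff, Set.mem_preimage, neg_add_cancel_left, chart_eq, map_add]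
    rw [← add_assoc, ← hx, and_comm]
  rw [heq, measure_preimage_add, Set.inter_comm (chart P₀ ⁻¹' S)]
  refine measure_inter_le_of_disjoint_translates (isAddFundamentalDomain_fundDomain F)
    measurableSet_fundDomain hA' hT (fun g => ?_) fun g g' hgg' => ?_
  · ext y
    rw [Set.mem_vadd_set_iff_neg_vadd_mem, Set.mem_preimage, Set.mem_preimage, chart_eq, chart_eq,
      toPic_vadd]
  · refine Set.disjoint_left.2 fun y hy hy' => hgg' ?_
    rw [Set.mem_vadd_set_iff_neg_vadd_mem, Set.mem_preimage] at hy hy'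
    have h := hinj hy hy' (by
      rw [chart_eq, chart_eq, map_add, map_add, toPic_vadd, toPic_vadd])
    rw [add_right_inj] at h
    have h' : -(g : InfDivisor0 F) + y = -(g' : InfDivisor0 F) + y := h
    rw [add_left_inj, neg_inj] at h'
    exact Subtype.ext h'

/-- The component of `[E]` depends only on the finite part of `E`, which lies in a discrete
group. -/
lemma isOpen_component (q : Components F) :
    IsOpen ((QuotientAddGroup.mk : Pic0 F → Components F) ⁻¹' {q}) := by
  let t : TopologicalSpace (HeightOneSpectrum (𝓞 F) →₀ ℤ) := ⊥
  have ht : DiscreteTopology (HeightOneSpectrum (𝓞 F) →₀ ℤ) := ⟨rfl⟩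
  set U : Set (Div0 F) := (QuotientAddGroup.mk : Div0 F → Pic0 F) ⁻¹'
    ((QuotientAddGroup.mk : Pic0 F → Components F) ⁻¹' {q})
  change IsOpen U
  have hcont : Continuous fun E : Div0 F => (E : ArakelovDivisor F).1 := by
    have h : Continuous fun E : ArakelovDivisor F => E.1 := continuous_fst
    exact h.comp continuous_subtype_val
  have hU : U = (fun E : Div0 F => (E : ArakelovDivisor F).1) ⁻¹'
      ((fun E : Div0 F => (E : ArakelovDivisor F).1) '' U) := by
    refine Set.Subset.antisymm (Set.subset_preimage_image _ _) ?_
    rintro E ⟨E', hE', h⟩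
    have hx : degInf F ((E : ArakelovDivisor F).2 - (E' : ArakelovDivisor F).2) = 0 := by
      have h1 : deg F (E : ArakelovDivisor F) = 0 := E.2
      have h2 : deg F (E' : ArakelovDivisor F) = 0 := E'.2
      rw [deg_apply] at h1 h2
      change (E' : ArakelovDivisor F).1 = (E : ArakelovDivisor F).1 at h
      rw [h] at h2
      rw [map_sub]
      linarith
    have hE : E' + ofInf ⟨_, hx⟩ = E := Subtype.ext (Prod.ext
      ((add_zero (E' : ArakelovDivisor F).1).trans h) (add_sub_cancel _ _))
    change (QuotientAddGroup.mk (QuotientAddGroup.mk E : Pic0 F) : Components F) = q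
    rw [← hE]
    refine Eq.trans ?_ hE'
    exact component_add_toPic (QuotientAddGroup.mk E' : Pic0 F) ⟨_, hx⟩
  rw [hU]
  exact (isOpen_discrete (α := HeightOneSpectrum (𝓞 F) →₀ ℤ) _).preimage hcont

/-- Every component of the Arakelov class group is a torus whose volume is the covolume of the unit
lattice. -/
lemma volPic0_eq [Countable (Components F)] :
    volPic0 F = ∑' _ : Components F, euclideanVolume F (fundDomain F) := by
  have huniv : ∀ q, componentMeasure F q Set.univ = euclideanVolume F (fundDomain F) := fun q => by
    rw [componentMeasure, Measure.map_apply (measurable_chart _) MeasurableSet.univ]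
    simp
  refine le_antisymm ?_ ?_
  · have hle : riemannianVolume F ≤ Measure.sum (componentMeasure F) :=
      iSup₂_le fun P A => iSup₂_le fun hA hinj =>
        (map_chart_le_componentMeasure P hA hinj).trans (Measure.le_sum _ _)
    refine (hle Set.univ).trans_eq ?_
    rw [Measure.sum_apply _ MeasurableSet.univ]
    exact tsum_congr huniv
  · have hC : ∀ q, euclideanVolume F (fundDomain F) ≤ riemannianVolume F
        ((QuotientAddGroup.mk : Pic0 F → Components F) ⁻¹' {q}) := fun q => by
      refine le_trans (le_of_eq ?_) (componentMeasure_le q _)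
      rw [← huniv q, componentMeasure, Measure.map_apply (measurable_chart _) MeasurableSet.univ,
        Measure.map_apply (measurable_chart _) (isOpen_component q).measurableSet]
      congr 1
      ext x
      simp only [Set.mem_preimage, Set.mem_univ, Set.mem_singleton_iff, true_iff, chart_eq]
      exact (component_add_toPic _ x).trans (Quotient.out_eq q)
    refine (ENNReal.tsum_le_tsum hC).trans ?_
    refine (tsum_meas_le_meas_iUnion_of_disjoint _ (fun q => (isOpen_component q).measurableSet)
      fun q q' hqq' => ?_).trans (measure_mono (Set.subset_univ _))
    exact (Set.disjoint_singleton.2 hqq').preimage _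

end Volume

/-! ### Balls and cubes -/

section Balls

variable {E : Type*} [NormedAddCommGroup E] [InnerProductSpace ℝ E] [FiniteDimensional ℝ E]
  [MeasurableSpace E] [BorelSpace E]

lemma volume_cube (s : ℝ) :
    volume {x : E | ∀ i, (stdOrthonormalBasis ℝ E).repr x i ∈ Set.Ioo (-s) s} =
      ENNReal.ofReal (2 * s) ^ Module.finrank ℝ E := by
  have h := (PiLp.volume_preserving_ofLp (Fin (Module.finrank ℝ E))).comp
    (stdOrthonormalBasis ℝ E).measurePreserving_repr
  have heq : {x : E | ∀ i, (stdOrthonormalBasis ℝ E).repr x i ∈ Set.Ioo (-s) s} =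
      (WithLp.ofLp ∘ (stdOrthonormalBasis ℝ E).repr) ⁻¹' (Set.univ.pi fun _ => Set.Ioo (-s) s) := by
    ext x
    simp
  rw [heq, h.measure_preimage (MeasurableSet.univ_pi fun _ => measurableSet_Ioo).nullMeasurableSet,
    volume_pi_pi]
  simp [two_mul]

lemma norm_sq_eq_sum_repr {E : Type*} [NormedAddCommGroup E] [InnerProductSpace ℝ E]
    [FiniteDimensional ℝ E] (x : E) : ‖x‖ ^ 2 = ∑ i, (stdOrthonormalBasis ℝ E).repr x i ^ 2 := by
  rw [← (stdOrthonormalBasis ℝ E).repr.norm_map x, EuclideanSpace.real_norm_sq_eq]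

/-- A ball contains the inscribed cube. In dimension zero the junk value of the side is harmless, as
both volumes are `1`. -/
lemma le_volume_ball {R : ℝ} (hR : 0 < R) :
    ENNReal.ofReal (2 * (R / √(Module.finrank ℝ E))) ^ Module.finrank ℝ E ≤
      volume (Metric.ball (0 : E) R) := by
  rw [← volume_cube]
  refine measure_mono fun x hx => mem_ball_zero_iff.2 ?_
  refine lt_of_pow_lt_pow_left₀ 2 hR.le ?_
  rw [norm_sq_eq_sum_repr]
  rcases isEmpty_or_nonempty (Fin (Module.finrank ℝ E)) with h | h
  · simpa using pow_pos hR 2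
  · have hr : (0 : ℝ) < Module.finrank ℝ E := Nat.cast_pos.2 (Fin.pos_iff_nonempty.2 h)
    calc ∑ i, (stdOrthonormalBasis ℝ E).repr x i ^ 2
        < ∑ _ : Fin (Module.finrank ℝ E), (R / √(Module.finrank ℝ E)) ^ 2 :=
          Finset.sum_lt_sum_of_nonempty Finset.univ_nonempty fun i _ => sq_lt_sq' (hx i).1 (hx i).2
      _ = R ^ 2 := by
          rw [Finset.sum_const, Finset.card_univ, Fintype.card_fin, nsmul_eq_mul, div_pow,
            Real.sq_sqrt hr.le]
          field_simp

/-- A closed ball is contained in every open cube that is larger than the circumscribed one. -/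
lemma volume_closedBall_le (L : ℝ) :
    volume (Metric.closedBall (0 : E) L) ≤ ENNReal.ofReal (2 * L) ^ Module.finrank ℝ E := by
  have hε : ∀ ε > 0, volume (Metric.closedBall (0 : E) L) ≤
      ENNReal.ofReal (2 * (L + ε)) ^ Module.finrank ℝ E := fun ε hε => by
    rw [← volume_cube]
    refine measure_mono fun x hx i => abs_lt.1 (lt_of_le_of_lt ?_ (lt_add_of_pos_right L hε))
    refine le_trans ?_ (mem_closedBall_zero_iff.1 hx)
    refine abs_le_of_sq_le_sq' ?_ (norm_nonneg x) |> abs_le.2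
    rw [norm_sq_eq_sum_repr]
    exact Finset.single_le_sum (f := fun i => (stdOrthonormalBasis ℝ E).repr x i ^ 2)
      (fun _ _ => sq_nonneg _) (Finset.mem_univ i)
  have hcont : Continuous fun ε : ℝ => ENNReal.ofReal (2 * (L + ε)) ^ Module.finrank ℝ E :=
    (ENNReal.continuous_pow _).comp (ENNReal.continuous_ofReal.comp (by fun_prop))
  have hlim := (hcont.tendsto 0).mono_left (nhdsWithin_le_nhds (s := Set.Ioi 0))
  rw [add_zero] at hlim
  exact ge_of_tendsto hlim (Filter.mem_of_superset self_mem_nhdsWithin hε)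

end Balls

/-! ### Counting reduced ideals by volume -/

section Counting

open scoped Pointwise

variable {F : Type*} [Field F] [NumberField F]

lemma euclideanVolume_eq : euclideanVolume F = volume :=
  (stdOrthonormalBasis ℝ (InfDivisor0 F)).addHaar_eq_volume

variable (F) in
/-- The component of the Arakelov class group in which the class of a reduced ideal lies. -/
def componentOf (I : reducedIdeals F) : Components F := QuotientAddGroup.mk (idealClass I.1)

lemma exists_idealClass_eq (I : reducedIdeals F) : ∃ x : InfDivisor0 F,
    idealClass I.1 = (componentOf F I).out + toPic F x :=
  exists_eq_out_add _

/-- The position of the class of a reduced ideal in its component. -/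
def position (I : reducedIdeals F) : InfDivisor0 F := (exists_idealClass_eq I).choose

lemma idealClass_eq (I : reducedIdeals F) :
    idealClass I.1 = (componentOf F I).out + toPic F (position I) :=
  (exists_idealClass_eq I).choose_spec

instance : Finite (reducedIdeals F) := finite_reducedIdeals F

lemma componentOf_surjective : Function.Surjective (componentOf F) := by
  intro q
  obtain ⟨P, rfl⟩ := QuotientAddGroup.mk_surjective q
  obtain ⟨I, hI, b, -, h⟩ := exists_reduced_near P
  exact ⟨⟨I, hI⟩, by rw [← h, component_add_toPic]; rfl⟩

instance : Finite (Components F) := Finite.of_surjective _ componentOf_surjective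

lemma tsum_fiber_eq (c : ENNReal) :
    ∑' q : Components F, ∑' _ : {I : reducedIdeals F // componentOf F I = q}, c =
      (reducedIdeals F).encard * c := by
  rw [← ENNReal.tsum_set_const, ← ENNReal.tsum_sigma
    (β := fun q => {I : reducedIdeals F // componentOf F I = q}) fun _ _ => c]
  exact (Equiv.sigmaFiberEquiv (componentOf F)).tsum_eq fun _ => c

variable (F) in
/-- The balls of radius `(log 2)/4` around the classes of reduced ideals overlap boundedly. -/
lemma encard_reducedIdeals_mul_le : (reducedIdeals F).encard *
    euclideanVolume F (Metric.ball 0 (Real.log 2 / 4)) ≤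
      (2 ^ Fintype.card (InfinitePlace F) * 4 ^ InfinitePlace.nrComplexPlaces F : ℕ) *
        volPic0 F := by
  rw [volPic0_eq, ← tsum_fiber_eq, ← ENNReal.tsum_mul_left]
  refine ENNReal.tsum_le_tsum fun q => ?_
  have h := tsum_measure_le_mul_of_encard_le (isAddFundamentalDomain_fundDomain F)
    (T := fun I : {I : reducedIdeals F // componentOf F I = q} =>
      Metric.ball (position I.1) (Real.log 2 / 4)) (fun _ => measurableSet_ball) fun a => by
    refine le_trans ?_ (encard_reduced_near_le (q.out + toPic F a))
    refine Set.encard_le_encard_of_injOn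
      (f := fun p => (p.1.1.1, -(p.2 : InfDivisor0 F) + a - position p.1.1)) ?_ ?_
    · rintro ⟨⟨I, hI⟩, g⟩ hp
      have hp' : -(g : InfDivisor0 F) + a ∈ Metric.ball (position I) (Real.log 2 / 4) :=
        Set.mem_vadd_set_iff_neg_vadd_mem.1 hp
      refine ⟨I.2, mem_ball_iff_norm.1 hp', ?_⟩
      rw [idealClass_eq, hI, map_sub, map_add, map_neg, AddMonoidHom.mem_ker.1 g.2]
      abel
    · rintro ⟨I, g⟩ - ⟨I', g'⟩ - hpp'
      obtain ⟨h1, h2⟩ := Prod.mk.inj hpp'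
      obtain rfl : I = I' := Subtype.ext (Subtype.ext h1)
      rw [sub_left_inj, add_left_inj, neg_inj] at h2
      exact Prod.ext rfl (Subtype.ext h2)
  simpa only [Measure.addHaar_ball_center] using h

variable (F) in
/-- The balls of radius `(1/2) log |Δ_F|` around the classes of reduced ideals cover. -/
lemma volPic0_le : volPic0 F ≤ (reducedIdeals F).encard *
    euclideanVolume F (Metric.closedBall 0 (Real.log |(discr F : ℝ)| / 2)) := by
  rw [volPic0_eq, ← tsum_fiber_eq]
  refine ENNReal.tsum_le_tsum fun q => ?_
  have h := measure_le_tsum_of_cover (isAddFundamentalDomain_fundDomain F)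
    (T := fun I : {I : reducedIdeals F // componentOf F I = q} =>
      Metric.closedBall (position I.1) (Real.log |(discr F : ℝ)| / 2)) fun a => by
    obtain ⟨I, hI, b, hb, h⟩ := exists_reduced_near (q.out + toPic F a)
    have hq : componentOf F ⟨I, hI⟩ = q := by
      have := congrArg (QuotientAddGroup.mk : Pic0 F → Components F) h
      rw [component_add_toPic, component_add_toPic] at this
      exact this.trans (Quotient.out_eq q)
    have hpos : idealClass I = q.out + toPic F (position ⟨I, hI⟩) := by
      rw [← hq]; exact idealClass_eq ⟨I, hI⟩
    have hker : a - (position ⟨I, hI⟩ + b) ∈ (toPic F).ker := by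
      rw [hpos, add_assoc, add_right_inj, ← map_add] at h
      rw [AddMonoidHom.mem_ker, map_sub, h, sub_self]
    refine ⟨⟨⟨I, hI⟩, hq⟩, ⟨_, hker⟩, Set.mem_vadd_set.2 ⟨position ⟨I, hI⟩ + b, ?_, ?_⟩⟩
    · rw [mem_closedBall_iff_norm, add_sub_cancel_left]
      exact hb
    · exact sub_add_cancel a _
  simpa only [Measure.addHaar_closedBall_center] using h

variable (F) in
lemma Red_eq_image : Red F = d '' reducedIdeals F := by
  ext D
  exact ⟨fun ⟨I, h, hI⟩ => ⟨I, hI, h.symm⟩, fun ⟨I, hI, h⟩ => ⟨I, h.symm, hI⟩⟩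

lemma d_injective : Function.Injective (d : (FractionalIdeal (𝓞 F)⁰ F)ˣ → ArakelovDivisor F) := by
  intro I J h
  exact Units.ext (idealDivisor_injective I.ne_zero J.ne_zero (neg_injective (congrArg Prod.fst h)))

lemma reducedIdeals_nonempty : (reducedIdeals F).Nonempty := by
  obtain ⟨I, hI, -⟩ := exists_reduced_near (0 : Pic0 F)
  exact ⟨I, hI⟩

end Counting

/-! ### The numerical estimates -/

section Estimates

lemma sixteen_le_log_two_sq_mul : 16 ≤ Real.log 2 ^ 2 * (8 * Real.pi * √2) := by
  have h1 : 0.69 ≤ Real.log 2 := by linarith [Real.log_two_gt_d9]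
  have h2 : 3.14 ≤ Real.pi := Real.pi_gt_d2.le
  have h3 : 1.41 ≤ √2 := Real.le_sqrt_of_sq_le (by norm_num)
  calc (16 : ℝ) ≤ 0.69 ^ 2 * (8 * 3.14 * 1.41) := by norm_num
    _ ≤ _ := by gcongr

/-- The packing bound in numbers: `r + 1` is the number of infinite places, `c` the number of
complex ones, and the base of the first power on the right is the side of the cube inscribed in a
ball of radius `(log 2)/4`. -/
lemma cells_le_cube_mul (r c : ℕ) {n : ℕ} (hn : n = r + 1 + c) :
    (2 : ℝ) ^ (r + 1) * 4 ^ c ≤ (2 * (Real.log 2 / 4 / √r)) ^ r *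
      (8 * Real.pi * n * √2) ^ ((n : ℝ) / 2) := by
  set K := 8 * Real.pi * √2 with hK
  have hK16 : 16 ≤ K := by
    have h1 : 3 ≤ Real.pi := Real.pi_gt_three.le
    have h2 : 1 ≤ √2 := Real.le_sqrt_of_sq_le (by norm_num)
    nlinarith
  have hlog : 0 < Real.log 2 := Real.log_pos one_lt_two
  have hn1 : (1 : ℝ) ≤ n := by exact_mod_cast (by omega : 1 ≤ n)
  have hrn : (r : ℝ) ≤ n := by exact_mod_cast (by omega : r ≤ n)
  have hpow : (8 * Real.pi * n * √2) ^ ((n : ℝ) / 2) = √(K * n) ^ n := by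
    rw [show 8 * Real.pi * n * √2 = K * n by rw [hK]; ring, Real.sqrt_eq_rpow, ← Real.rpow_natCast,
      ← Real.rpow_mul (by positivity)]
    congr 1
    ring
  have h4 : 4 ≤ √(K * n) := Real.le_sqrt_of_sq_le (by nlinarith)
  have hone : 1 ≤ (Real.log 2 / 4 / √r * √(K * n)) ^ r := by
    rcases Nat.eq_zero_or_pos r with rfl | hr
    · simp
    · refine one_le_pow₀ ?_
      have hr' : (0 : ℝ) < r := Nat.cast_pos.2 hr
      rw [div_mul_eq_mul_div, one_le_div (Real.sqrt_pos.2 hr')]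
      refine Real.sqrt_le_iff.2 ⟨by positivity, ?_⟩
      rw [mul_pow, Real.sq_sqrt (by positivity), div_pow]
      have := sixteen_le_log_two_sq_mul
      calc (r : ℝ) ≤ 1 * n := by linarith
        _ ≤ (Real.log 2 ^ 2 * K / 16) * n := by gcongr; linarith
        _ = _ := by ring
  calc (2 : ℝ) ^ (r + 1) * 4 ^ c ≤ 2 ^ r * 4 ^ (1 + c) := by
        rw [pow_succ, pow_add]
        have : (0 : ℝ) < 2 ^ r * 4 ^ c := by positivity
        linarith
    _ ≤ 2 ^ r * ((Real.log 2 / 4 / √r * √(K * n)) ^ r * √(K * n) ^ (1 + c)) := by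
        gcongr
        refine le_trans ?_ (le_mul_of_one_le_left (by positivity) hone)
        gcongr
    _ = _ := by
        rw [hpow, hn, add_assoc, pow_add _ r, mul_pow, mul_pow]
        ring

lemma one_le_log_abs_discr {F : Type*} [Field F] [NumberField F] (h : 2 ≤ Module.finrank ℚ F) :
    1 ≤ Real.log |(discr F : ℝ)| := by
  have h3 : (3 : ℝ) ≤ |(discr F : ℝ)| := by
    have := abs_discr_gt_two (K := F) h
    exact_mod_cast this
  rw [Real.le_log_iff_exp_le (by linarith)]
  linarith [Real.exp_one_lt_d9]

end Estimates

end ArakelovClassGroup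

end

theorem corollary7p10 (F : Type*) [Field F] [NumberField F] :
    (ArakelovClassGroup.Red F).Finite ∧
    0 < ArakelovClassGroup.volPic0 F ∧ ArakelovClassGroup.volPic0 F < ⊤ ∧
    (2 ≤ Module.finrank ℚ F →
      ((Real.log |(NumberField.discr F : ℝ)|) ^ Module.finrank ℚ F)⁻¹ ≤
        ((ArakelovClassGroup.Red F).ncard : ℝ) / (ArakelovClassGroup.volPic0 F).toReal) ∧
    ((ArakelovClassGroup.Red F).ncard : ℝ) / (ArakelovClassGroup.volPic0 F).toReal ≤
      (8 * Real.pi * (Module.finrank ℚ F : ℝ) * Real.sqrt 2) ^ ((Module.finrank ℚ F : ℝ) / 2) := by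
  open ArakelovClassGroup in
  have hfin := finite_reducedIdeals F
  have hncard : (Red F).ncard = (reducedIdeals F).ncard := by
    rw [Red_eq_image, Set.ncard_image_of_injective _ d_injective]
  have hencard : (reducedIdeals F).encard = ((Red F).ncard : ℕ∞) := by
    rw [hncard, hfin.cast_ncard_eq]
  set N := (Red F).ncard
  set r := NumberField.Units.rank F with hr
  have hNpos : 0 < N := by
    rw [hncard]
    exact (Set.ncard_pos hfin).2 reducedIdeals_nonempty
  have hcard : Fintype.card (NumberField.InfinitePlace F) = r + 1 := by
    have : 0 < Fintype.card (NumberField.InfinitePlace F) := Fintype.card_pos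
    rw [hr, NumberField.Units.rank]
    omega
  have hn : Module.finrank ℚ F = r + 1 + NumberField.InfinitePlace.nrComplexPlaces F := by
    rw [← NumberField.InfinitePlace.card_add_two_mul_card_eq_rank, ← hcard,
      NumberField.InfinitePlace.card_eq_nrRealPlaces_add_nrComplexPlaces]
    ring
  have hlog2 : 0 < Real.log 2 := Real.log_pos one_lt_two
  have hup := encard_reducedIdeals_mul_le F
  have hlow := volPic0_le F
  rw [hencard, ENat.toENNReal_coe] at hup hlow
  set c := NumberField.InfinitePlace.nrComplexPlaces F
  have hball : ENNReal.ofReal (2 * (Real.log 2 / 4 / √r)) ^ r ≤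
      euclideanVolume F (Metric.ball 0 (Real.log 2 / 4)) := by
    have := le_volume_ball (E := InfDivisor0 F) (R := Real.log 2 / 4) (by positivity)
    rwa [finrank_infDivisor0, ← euclideanVolume_eq] at this
  have hclosed : euclideanVolume F
      (Metric.closedBall 0 (Real.log |(NumberField.discr F : ℝ)| / 2)) ≤
      ENNReal.ofReal (Real.log |(NumberField.discr F : ℝ)|) ^ r := by
    have := volume_closedBall_le (E := InfDivisor0 F) (Real.log |(NumberField.discr F : ℝ)| / 2)
    rwa [finrank_infDivisor0, ← euclideanVolume_eq, mul_div_cancel₀ _ two_ne_zero] at this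
  have hlow' : volPic0 F ≤ N * ENNReal.ofReal (Real.log |(NumberField.discr F : ℝ)|) ^ r :=
    hlow.trans (by gcongr)
  have hup' : N * ENNReal.ofReal (2 * (Real.log 2 / 4 / √r)) ^ r ≤
      (2 ^ Fintype.card (NumberField.InfinitePlace F) * 4 ^ c : ℕ) * volPic0 F :=
    le_trans (by gcongr) hup
  have hside : 0 < (2 * (Real.log 2 / 4 / √r)) ^ r := by
    rcases Nat.eq_zero_or_pos r with h | h
    · rw [h]; simp
    · have : (0 : ℝ) < r := Nat.cast_pos.2 h
      positivity
  have htop : volPic0 F < ⊤ := hlow'.trans_lt (ENNReal.mul_lt_top (ENNReal.natCast_lt_top N)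
    (ENNReal.pow_lt_top ENNReal.ofReal_lt_top))
  rw [← ENNReal.ofReal_pow (by positivity)] at hup'
  have hpos : 0 < volPic0 F := by
    refine pos_iff_ne_zero.2 fun h => ?_
    rw [h, mul_zero, nonpos_iff_eq_zero, mul_eq_zero, Nat.cast_eq_zero, ENNReal.ofReal_eq_zero]
      at hup'
    rcases hup' with h' | h'
    · exact hNpos.ne' h'
    · exact hside.not_ge h'
  have hv : 0 < (volPic0 F).toReal := ENNReal.toReal_pos hpos.ne' htop.ne
  refine ⟨by rw [Red_eq_image]; exact hfin.image _, hpos, htop, fun h2 => ?_, ?_⟩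
  · have hlog := one_le_log_abs_discr h2
    have h := ENNReal.toReal_mono (ENNReal.mul_ne_top (ENNReal.natCast_ne_top N)
      (ENNReal.pow_ne_top ENNReal.ofReal_ne_top)) hlow'
    rw [ENNReal.toReal_mul, ENNReal.toReal_natCast, ENNReal.toReal_pow,
      ENNReal.toReal_ofReal (by linarith)] at h
    rw [inv_le_comm₀ (by positivity) (by positivity), inv_div, div_le_iff₀ (by positivity),
      mul_comm]
    refine h.trans ?_
    gcongr
    omega
  · have h := ENNReal.toReal_mono (ENNReal.mul_ne_top (ENNReal.natCast_ne_top _) htop.ne) hup'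
    rw [ENNReal.toReal_mul, ENNReal.toReal_mul, ENNReal.toReal_natCast, ENNReal.toReal_natCast,
      ENNReal.toReal_ofReal hside.le, hcard] at h
    push_cast at h
    rw [div_le_iff₀ hv]
    refine le_of_mul_le_mul_right (h.trans ?_) hside
    calc _ ≤ _ := mul_le_mul_of_nonneg_right (cells_le_cube_mul r c hn) hv.le
      _ = _ := by ring
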